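/- For a non-negative integer $n$ let $\mathrm{ped}(n)$ (resp. $\mathrm{pod}(n)$) be the number of partitions of $n$ in which the even (resp. odd) parts are distinct. An overpartition of $n$ is a partition of $n$ in which the first occurrence of each part size may be overlined; let $\overline{p}(n)$ be the number of overpartitions of $n$, and $\overline{p_o}(n)$ the number of overpartitions of $n$ all of whose parts are odd. For an integer $r\ge 1$ put $f_r=\prod_{n=1}^{\infty}(1-q^{rn})$. Then the following identities of power series in $q$ hold: \begin{enumerate} \item $$\sum_{n=0}^\infty \mathrm{ped}(9n+1)q^n = \frac{f_2^2 f_3^4 f_4}{f_1^5 f_6^2} + 24q\, \frac{f_2^3 f_3^3 f_4 f_6^3}{f_1^{10}}.$$ \item $$\sum_{n=0}^\infty \mathrm{pod}(9n+8) q^n = 10\, \frac{f_2 f_6^{24}}{f_1^7 f_3^6 f_4^7 f_{12}^6} + 16q\, \frac{f_2^7 f_3^3 f_6^6 f_{12}^3}{f_1^{10} f_4^{10}} + q^2\, \frac{f_2^{13} f_3^{12} f_{12}^{12}}{f_1^{13} f_4^{13} f_6^{12}}.$$ \item $$\sum_{n=0}^\infty \overline{p_o}(9n)q^n = \frac{f_2^5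 f_3^4}{f_1^6 f_4 f_6^2}+24q\,\frac{f_2^6 f_3^3 f_6^3}{f_1^{11} f_4}.$$ \item $$\sum_{n=0}^\infty \overline{p}(9n) q^n = \frac{f_2^{13} f_3^{24}}{f_1^{26} f_6^{12}} + 128q\, \frac{f_2^{10} f_3^{15}}{f_1^{23} f_6^3} + 640q^2\, \frac{f_2^7 f_3^6 f_6^6}{f_1^{20}}.$$ \end{enumerate} -/

import Mathlib

open scoped PowerSeries.WithPiTopology

/-- `ped n`: the number of partitions of `n` in which the even parts are distinct. -/
def ped (n : ℕ) : ℕ :=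
  (Finset.univ.filter fun p : n.Partition => ∀ i ∈ p.parts, Even i → p.parts.count i = 1).card

/-- `pod n`: the number of partitions of `n` in which the odd parts are distinct. -/
def pod (n : ℕ) : ℕ :=
  (Finset.univ.filter fun p : n.Partition => ∀ i ∈ p.parts, Odd i → p.parts.count i = 1).card

/-- An overpartition of `n`: a partition of `n` in which the first occurrence of each part size
may be overlined. It is recorded as a partition together with the set of those part sizes whose
first occurrence is overlined. -/
structure Overpartition (n : ℕ) where
  /-- the underlying partition -/
  partition : n.Partition
  /-- the part sizes whose first occurrence is overlined -/
  overlined : Finset ℕ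
  overlined_subset : overlined ⊆ partition.parts.toFinset

/-- Overpartitions as pairs of a partition and a subset of its set of part sizes. -/
def Overpartition.equivSigma (n : ℕ) :
    Overpartition n ≃ (Σ p : n.Partition, {s : Finset ℕ // s ∈ p.parts.toFinset.powerset}) where
  toFun π := ⟨π.partition, π.overlined, Finset.mem_powerset.2 π.overlined_subset⟩
  invFun x := ⟨x.1, x.2.1, Finset.mem_powerset.1 x.2.2⟩
  left_inv _ := rfl
  right_inv _ := rfl

instance Overpartition.instFintype (n : ℕ) : Fintype (Overpartition n) :=
  Fintype.ofEquiv _ (Overpartition.equivSigma n).symm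

/-- The number of overpartitions of `n`. -/
def overp (n : ℕ) : ℕ := Fintype.card (Overpartition n)

/-- The number of overpartitions of `n` all of whose parts are odd. -/
def overpOdd (n : ℕ) : ℕ :=
  (Finset.univ.filter fun π : Overpartition n => ∀ i ∈ π.partition.parts, Odd i).card

/-- The formal power series `f_r = ∏_{n ≥ 1} (1 - q ^ (r n))`, with `q = X`. -/
noncomputable def fq (r : ℕ) : PowerSeries ℚ :=
  ∏' n : ℕ, (1 - PowerSeries.X ^ (r * (n + 1)))

/-- The infinite product defining `f_r` converges for `r ≥ 1`. -/
theorem fq_multipliable {r : ℕ} (hr : 0 < r) :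
    Multipliable fun n : ℕ => (1 - PowerSeries.X ^ (r * (n + 1)) : PowerSeries ℚ) := by
  simp_rw [sub_eq_add_neg]
  apply PowerSeries.WithPiTopology.multipliable_one_add_of_tendsto_order_atTop_nhds_top
  refine ENat.tendsto_nhds_top_iff_natCast_lt.mpr fun n => Filter.eventually_atTop.mpr ⟨n, ?_⟩
  intro m hm
  rw [PowerSeries.order_neg, PowerSeries.order_X_pow]
  norm_cast
  nlinarith

/-- `f_r` has constant term `1`, so that it is invertible and its inverse is the true one. -/
theorem fq_constantCoeff {r : ℕ} (hr : 0 < r) : PowerSeries.constantCoeff (fq r) = 1 := by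
  rw [fq, (fq_multipliable hr).map_tprod PowerSeries.constantCoeff
    (PowerSeries.WithPiTopology.continuous_constantCoeff ℚ)]
  simp [hr.ne']

open PowerSeries Finset

/-! ### Infinite products as X-adic limits of finite products -/

section Pochhammer

variable {R : Type*} [CommRing R]

/-! Write φ(-q) = f_1²/f_2, ψ(-q) = f_1 f_4/f_2, Ω = f(-q, -q⁵) and A = f(-q, q²). The four
generating functions are quotients of theta functions: 1/φ(-q) for overpartitions, 1/ψ(-q) for pod,
ψ(-q)/φ(-q) for ped and φ(-q²)/φ(-q) for overpartitions into odd parts. Extracting the exponents in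
a class mod 9 means extracting a class mod 3 twice.

The Jacobi triple product, split by the summation index mod 3, gives φ(-q) = φ(-q⁹) - 2q Ω(q³) and
ψ(-q) = A(q³) - q ψ(-q⁹). Each has the form a(q³) - q b(q³), so multiplying by `cubicCofactor`,
namely a² + qab + q²b² at q³, turns it into N(q³) with N = a³ - q b³. A reciprocal is thus a
polynomial of degree 2 in q over a series in q³, and its sections can be read off.

To extract again, N must be related to the original theta function. The product over the conjugates
q ↦ ωq, ω a primitive cube root of unity, is N(q³) by the dissection and an explicit product by the
Euler factors. Comparing the two gives N(q) φ(-q³) = φ(-q)⁴ and its analogue for ψ (`phiNeg_cubic`,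
`psiNeg_cubic`). For the reciprocals, the first section is a cube at q³ over the fourth power of the
same theta function, and the second comes from the fourth power of the cofactor.

For the two mixed quotients the first section is a difference of two products. Relations of level 12
(`level_twelve_relations`), derived algebraically from the cubic identities at q and q², collapse it
to φ(-q³)ψ(-q³)/φ(-q)², respectively φ(-q³)φ(-q⁶)/φ(-q)², and the second section uses the square of
the cofactor. -/

theorem eq_of_forall_X_pow_dvd_sub {F G : R⟦X⟧} (h : ∀ N : ℕ, X ^ N ∣ F - G) : F = G := by
  ext n
  have := X_pow_dvd_iff.1 (h (n + 1)) n (Nat.lt_succ_self n)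
  rwa [map_sub, sub_eq_zero] at this

/-- The finite product `∏_{k < N} (1 + c q ^ (a + m k))`. -/
noncomputable def pochFin (c : R) (a m N : ℕ) : R⟦X⟧ :=
  ∏ k ∈ range N, (1 + C c * X ^ (a + m * k))

/-- The infinite product `∏_{k ≥ 0} (1 + c q ^ (a + m k))`, for `m ≥ 1`. -/
noncomputable def poch (c : R) (a m : ℕ) : R⟦X⟧ :=
  PowerSeries.mk fun n => coeff n (pochFin c a m (n + 1))

theorem X_pow_dvd_pochFin_sub (c : R) (a : ℕ) {m : ℕ} (hm : 0 < m) {N M : ℕ} (h : N ≤ M) :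
    X ^ N ∣ pochFin c a m M - pochFin c a m N := by
  induction M, h using Nat.le_induction with
  | base => simp
  | succ M hM ih =>
    have e : pochFin c a m (M + 1) - pochFin c a m N
        = (pochFin c a m M - pochFin c a m N)
          + pochFin c a m M * C c * X ^ (a + m * M) := by
      rw [pochFin, prod_range_succ, ← pochFin]; ring
    rw [e]
    refine dvd_add ih (Dvd.dvd.mul_left (pow_dvd_pow _ ?_) _)
    nlinarith

theorem X_pow_dvd_poch_sub (c : R) (a : ℕ) {m : ℕ} (hm : 0 < m) {N M : ℕ} (h : N ≤ M) :
    X ^ N ∣ poch c a m - pochFin c a m M := by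
  rw [X_pow_dvd_iff]
  intro d hd
  have := X_pow_dvd_iff.1 (X_pow_dvd_pochFin_sub c a hm (show d + 1 ≤ M by omega)) d
    (Nat.lt_succ_self d)
  rw [map_sub, sub_eq_zero] at this ⊢
  rw [this, poch, coeff_mk]

/-- The device by which every product identity below is lifted from finite products. The number of
factors `M` may exceed the precision `N`, which leaves room for regrouping and shifting factors. -/
theorem eq_poch (c : R) (a : ℕ) {m : ℕ} (hm : 0 < m) {F : R⟦X⟧}
    (h : ∀ N : ℕ, ∃ M, N ≤ M ∧ X ^ N ∣ F - pochFin c a m M) : F = poch c a m := by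
  refine eq_of_forall_X_pow_dvd_sub fun N => ?_
  obtain ⟨M, hM, hF⟩ := h N
  have := dvd_sub hF (X_pow_dvd_poch_sub c a hm hM)
  rwa [sub_sub_sub_cancel_right] at this

theorem dvd_prod_sub_prod {ι S : Type*} [CommRing S] {k : S} {F G : ι → S} (s : Finset ι)
    (h : ∀ i ∈ s, k ∣ F i - G i) : k ∣ ∏ i ∈ s, F i - ∏ i ∈ s, G i := by
  classical
  induction s using Finset.induction_on with
  | empty => simp
  | insert i s hi ih =>
    rw [prod_insert hi, prod_insert hi]
    exact dvd_mul_sub_mul (h i (mem_insert_self i s))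
      (ih fun j hj => h j (mem_insert_of_mem hj))

theorem poch_mul_poch_neg (c : R) (a : ℕ) {m : ℕ} (hm : 0 < m) :
    poch c a m * poch (-c) a m = poch (-c ^ 2) (2 * a) (2 * m) := by
  refine eq_poch _ _ (by omega) fun N => ⟨N, le_rfl, ?_⟩
  have e : pochFin (-c ^ 2) (2 * a) (2 * m) N = pochFin c a m N * pochFin (-c) a m N := by
    rw [pochFin, pochFin, pochFin, ← prod_mul_distrib]
    refine prod_congr rfl fun k _ => ?_
    simp only [map_neg, map_pow]
    ring
  rw [e]
  exact dvd_mul_sub_mul (X_pow_dvd_poch_sub _ _ hm le_rfl) (X_pow_dvd_poch_sub _ _ hm le_rfl)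

theorem pochFin_mul (c : R) (a m k N : ℕ) :
    pochFin c a m (k * N) = ∏ i ∈ range k, pochFin c (a + m * i) (k * m) N := by
  induction N with
  | zero => simp [pochFin]
  | succ N ih =>
    rw [Nat.mul_succ, pochFin, prod_range_add, ← pochFin, ih, ← prod_mul_distrib]
    refine prod_congr rfl fun i _ => ?_
    rw [pochFin, pochFin, prod_range_succ]
    congr 4
    ring

/-- Splitting an infinite product according to the residue of the index modulo `k`. -/
theorem poch_split (c : R) (a : ℕ) {m k : ℕ} (hm : 0 < m) (hk : 0 < k) :
    poch c a m = ∏ i ∈ range k, poch c (a + m * i) (k * m) := by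
  symm
  refine eq_poch _ _ hm fun N => ⟨k * N, Nat.le_mul_of_pos_left N hk, ?_⟩
  rw [pochFin_mul]
  exact dvd_prod_sub_prod _ fun i _ => X_pow_dvd_poch_sub _ _ (Nat.mul_pos hk hm) le_rfl

theorem expand_poch (c : R) (a : ℕ) {m r : ℕ} (hm : 0 < m) (hr : r ≠ 0) :
    expand r hr (poch c a m) = poch c (r * a) (r * m) := by
  refine eq_poch _ _ (by positivity) fun N => ⟨N, le_rfl, ?_⟩
  have e : expand r hr (pochFin c a m N) = pochFin c (r * a) (r * m) N := by
    simp only [pochFin, map_prod, map_add, map_one, map_mul, map_pow, expand_C, expand_X]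
    refine prod_congr rfl fun k _ => ?_
    rw [← pow_mul]; congr 3; ring
  rw [← e, ← map_sub]
  have := map_dvd (expand r hr) (X_pow_dvd_poch_sub c a hm (le_refl N))
  rw [map_pow, expand_X, ← pow_mul] at this
  exact (pow_dvd_pow _ (Nat.le_mul_of_pos_left N (Nat.pos_of_ne_zero hr))).trans this

theorem rescale_C_apply (w c : R) : rescale w (C c : R⟦X⟧) = C c := by
  ext n
  rw [coeff_rescale, coeff_C]
  split_ifs with h <;> simp [h]

/-- Since `w ^ m = 1`, every factor is twisted by the same constant `w ^ a`. -/
theorem rescale_poch (c w : R) (a : ℕ) {m : ℕ} (hm : 0 < m) (hw : w ^ m = 1) :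
    rescale w (poch c a m) = poch (c * w ^ a) a m := by
  refine eq_poch _ _ hm fun N => ⟨N, le_rfl, ?_⟩
  have e : rescale w (pochFin c a m N) = pochFin (c * w ^ a) a m N := by
    simp only [pochFin, map_prod, map_add, map_one, map_mul, map_pow, rescale_X, rescale_C_apply]
    refine prod_congr rfl fun k _ => ?_
    rw [mul_pow, pow_add (C w) a, pow_mul (C w), ← map_pow C w m, hw]
    simp only [map_one, one_pow]
    ring
  rw [← e, ← map_sub]
  have := map_dvd (rescale w) (X_pow_dvd_poch_sub c a hm (le_refl N))
  rw [map_pow, rescale_X, mul_pow] at this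
  exact (Dvd.intro_left _ rfl).trans this

theorem map_poch {S : Type*} [CommRing S] (g : R →+* S) (c : R) (a : ℕ) {m : ℕ} (hm : 0 < m) :
    PowerSeries.map g (poch c a m) = poch (g c) a m := by
  refine eq_poch _ _ hm fun N => ⟨N, le_rfl, ?_⟩
  have e : PowerSeries.map g (pochFin c a m N) = pochFin (g c) a m N := by
    simp [pochFin, map_prod]
  rw [← e, ← map_sub]
  have := map_dvd (PowerSeries.map g) (X_pow_dvd_poch_sub c a hm (le_refl N))
  rwa [map_pow, map_X] at this

theorem constantCoeff_poch (c : R) {a : ℕ} (ha : 0 < a) (m : ℕ) :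
    constantCoeff (poch c a m) = 1 := by
  rw [← coeff_zero_eq_constantCoeff_apply, poch, coeff_mk]
  simp [pochFin, ha.ne']

theorem isUnit_poch (c : R) {a : ℕ} (ha : 0 < a) (m : ℕ) : IsUnit (poch c a m) := by
  rw [isUnit_iff_constantCoeff, constantCoeff_poch c ha]
  exact isUnit_one

end Pochhammer

/-! ### The q-binomial theorem and the Jacobi triple product -/

section JacobiTripleProduct

variable {R : Type*} [CommRing R]

/-- The Gaussian binomial coefficients in the variable `Q`. -/
def gaussBinom {S : Type*} [CommRing S] (Q : S) : ℕ → ℕ → S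
  | _, 0 => 1
  | 0, _ + 1 => 0
  | n + 1, i + 1 => gaussBinom Q n i + Q ^ (i + 1) * gaussBinom Q n (i + 1)

theorem gaussBinom_zero_right {S : Type*} [CommRing S] (Q : S) (n : ℕ) :
    gaussBinom Q n 0 = 1 := by
  cases n <;> rfl

theorem gaussBinom_eq_zero {S : Type*} [CommRing S] (Q : S) {n i : ℕ} (h : n < i) :
    gaussBinom Q n i = 0 := by
  induction n generalizing i with
  | zero => obtain ⟨i, rfl⟩ := Nat.exists_eq_add_of_lt h; simp [gaussBinom]
  | succ n ih =>
    obtain _ | i := i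
    · omega
    · rw [gaussBinom, ih (by omega), ih (by omega)]; simp

theorem gaussBinom_mul {S : Type*} [CommRing S] (Q : S) (i j : ℕ) :
    gaussBinom Q (i + j) i * ((∏ k ∈ range i, (1 - Q ^ (k + 1))) *
      ∏ k ∈ range j, (1 - Q ^ (k + 1))) = ∏ k ∈ range (i + j), (1 - Q ^ (k + 1)) := by
  induction i generalizing j with
  | zero => simp [gaussBinom_zero_right]
  | succ i ihi =>
    induction j with
    | zero =>
      have := ihi 0
      have h0 := gaussBinom_eq_zero Q (Nat.lt_succ_self i)
      simp only [add_zero, range_zero, prod_empty, mul_one, gaussBinom, prod_range_succ,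
        Nat.succ_eq_add_one] at this h0 ⊢
      rw [h0]
      linear_combination (1 - Q ^ (i + 1)) * this
    | succ j ihj =>
      have h1 := ihi (j + 1)
      rw [show i + 1 + (j + 1) = (i + j + 1) + 1 by ring, gaussBinom,
        prod_range_succ _ (i + j + 1)]
      rw [show i + (j + 1) = i + j + 1 by ring] at h1
      rw [show i + 1 + j = i + j + 1 by ring] at ihj
      rw [prod_range_succ _ i] at ihj ⊢
      rw [prod_range_succ _ j] at h1 ⊢
      have e : Q ^ (i + j + 1 + 1) = Q ^ (i + 1) * Q ^ (j + 1) := by ring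
      rw [e]
      linear_combination (1 - Q ^ (i + 1)) * h1 + Q ^ (i + 1) * (1 - Q ^ (j + 1)) * ihj

/-- The `q`-binomial theorem. -/
theorem prod_add_mul_pow {S : Type*} [CommRing S] (Q y z : S) (n : ℕ) :
    ∏ k ∈ range n, (y + z * Q ^ k) =
      ∑ i ∈ range (n + 1), gaussBinom Q n i * Q ^ (i.choose 2) * z ^ i * y ^ (n - i) := by
  induction n generalizing z with
  | zero => simp [gaussBinom]
  | succ n ih =>
    -- Peeling off the factor `k = 0` leaves the same product with `z` replaced by `z * Q`, which is
    -- why the induction generalizes `z`.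
    have e : ∏ k ∈ range (n + 1), (y + z * Q ^ k)
        = (y + z) * ∏ k ∈ range n, (y + (z * Q) * Q ^ k) := by
      rw [prod_range_succ', mul_comm]
      simp only [pow_zero, mul_one]
      congr 1
      exact prod_congr rfl fun k _ => by ring
    rw [e, ih, sum_range_succ' _ (n + 1), add_mul]
    have h1 : y * ∑ i ∈ range (n + 1),
          gaussBinom Q n i * Q ^ (i.choose 2) * (z * Q) ^ i * y ^ (n - i)
        = ∑ i ∈ range (n + 1), Q ^ (i + 1) * gaussBinom Q n (i + 1) * Q ^ ((i + 1).choose 2)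
            * z ^ (i + 1) * y ^ (n - i) + y ^ (n + 1) := by
      rw [sum_range_succ', sum_range_succ, gaussBinom_eq_zero Q (Nat.lt_succ_self n), mul_add,
        mul_sum]
      simp only [gaussBinom_zero_right, Nat.choose_zero_succ, pow_zero, tsub_zero, mul_zero,
        zero_mul, add_zero, one_mul, mul_one]
      congr 1
      · refine sum_congr rfl fun i hi => ?_
        rw [show n - i = (n - (i + 1)) + 1 by have := mem_range.1 hi; omega, mul_pow]
        ring
      · ring
    have h2 : z * ∑ i ∈ range (n + 1),
          gaussBinom Q n i * Q ^ (i.choose 2) * (z * Q) ^ i * y ^ (n - i)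
        = ∑ i ∈ range (n + 1), gaussBinom Q n i * Q ^ ((i + 1).choose 2)
            * z ^ (i + 1) * y ^ (n - i) := by
      rw [mul_sum]
      refine sum_congr rfl fun i _ => ?_
      rw [Nat.choose_succ_succ' i 1, Nat.choose_one_right, mul_pow, pow_add]
      ring
    rw [h1, h2, add_right_comm, ← sum_add_distrib]
    simp only [gaussBinom_zero_right, Nat.choose_zero_succ, pow_zero, tsub_zero, mul_one, one_mul]
    congr 1
    refine sum_congr rfl fun i _ => ?_
    rw [gaussBinom, Nat.add_sub_add_right]
    ring

/-- The triangular number `j (j + 1) / 2` of an integer `j`. -/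
def triangular (j : ℤ) : ℕ := (j * (j + 1) / 2).toNat

theorem two_mul_triangular (j : ℤ) : 2 * (triangular j : ℤ) = j * (j + 1) := by
  have h0 : 0 ≤ j * (j + 1) := by
    rcases le_or_gt 0 j with h | h
    · positivity
    · nlinarith
  rw [triangular, Int.toNat_of_nonneg (by positivity)]
  exact Int.mul_ediv_cancel' (Int.even_mul_succ_self j).two_dvd

/-- The term `ε ^ j q ^ (a j (j + 1) / 2 + b j (j - 1) / 2)` of the theta series, for `ε = ±1`. -/
noncomputable def thetaTerm (ε : R) (a b : ℕ) (j : ℤ) : R⟦X⟧ :=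
  C (ε ^ j.natAbs) * X ^ (a * triangular j + b * triangular (-j))

/-- The product side of the triple product for Ramanujan's theta function `f (ε q ^ a, ε q ^ b)`. -/
noncomputable def theta (ε : R) (a b : ℕ) : R⟦X⟧ :=
  poch ε a (a + b) * poch ε b (a + b) * poch (-1) (a + b) (a + b)

theorem theta_comm (ε : R) (a b : ℕ) : theta ε a b = theta ε b a := by
  rw [theta, theta, add_comm b a]; ring

theorem pow_eq_pow_of_mod_two {ε : R} (hε : ε * ε = 1) {m n : ℕ} (h : m % 2 = n % 2) :
    ε ^ m = ε ^ n := by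
  have key (k : ℕ) : ε ^ k = ε ^ (k % 2) := by
    conv_lhs => rw [← Nat.mod_add_div k 2, pow_add, pow_mul, pow_two, hε, one_pow, mul_one]
  rw [key m, key n, h]

theorem sum_range_eq_sum_Icc {S : Type*} [AddCommMonoid S] (g : ℤ → S) (N : ℕ) :
    ∑ i ∈ range (2 * N + 1), g ((i : ℤ) - N) = ∑ j ∈ Icc (-(N : ℤ)) N, g j := by
  refine sum_nbij' (fun i => (i : ℤ) - N) (fun j => (j + N).toNat) ?_ ?_ ?_ ?_ ?_
  · intro i hi; simp only [mem_range, mem_Icc] at *; omega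
  · intro i hi; simp only [mem_range, mem_Icc] at *; omega
  · intro i hi; simp
  · intro j hj; simp only [mem_Icc] at *; omega
  · intro i hi; rfl

/-- The finite form of the Jacobi triple product. -/
theorem pochFin_mul_pochFin {ε : R} (hε : ε * ε = 1) (a b N : ℕ) :
    pochFin ε a (a + b) N * pochFin ε b (a + b) N =
      ∑ i ∈ range (2 * N + 1),
        gaussBinom (X ^ (a + b)) (2 * N) i * thetaTerm ε a b ((i : ℤ) - N) := by
  set m := a + b with hm
  -- The homogeneous form, with `y = X ^ (m * N)`, avoids negative exponents: the upper half of the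
  -- `2 * N` factors gives the product starting at `a`, the lower half read backwards the one
  -- starting at `b`, each up to a monomial that is cancelled at the end.
  have key := prod_add_mul_pow (X ^ m : R⟦X⟧) (X ^ (m * N)) (C ε * X ^ a) (2 * N)
  have hCε : (C ε : R⟦X⟧) * C ε = 1 := by rw [← map_mul, hε, map_one]
  have hA : ∏ k ∈ range N, (X ^ (m * N) + C ε * X ^ a * (X ^ m) ^ (N + k))
      = X ^ (m * N * N) * pochFin ε a m N := by
    have : (X : R⟦X⟧) ^ (m * N * N) = ∏ _k ∈ range N, X ^ (m * N) := by simp [pow_mul]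
    rw [this, pochFin, ← prod_mul_distrib]
    exact prod_congr rfl fun k _ => by ring
  have hB : ∏ k ∈ range N, (X ^ (m * N) + C ε * X ^ a * (X ^ m) ^ k)
      = C ε ^ N * X ^ (a * N + m * N.choose 2) * pochFin ε b m N := by
    have h1 : C ε ^ N * X ^ (a * N + m * N.choose 2)
        = ∏ k ∈ range N, (C ε * X ^ a * (X ^ m) ^ k) := by
      rw [prod_mul_distrib, prod_const, card_range, prod_pow_eq_pow_sum, sum_range_id,
        ← Nat.choose_two_right]
      ring
    rw [h1, ← prod_range_reflect (fun k => C ε * X ^ a * (X ^ m) ^ k),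
      ← prod_range_reflect, pochFin, ← prod_mul_distrib]
    refine prod_congr rfl fun k hk => ?_
    have e : m * N = a + m * (N - 1 - k) + (b + m * k) := by
      have : N = (N - 1 - k) + k + 1 := by have := mem_range.1 hk; omega
      conv_lhs => rw [this]
      rw [mul_add, mul_add, hm]; ring
    rw [e, pow_add _ (a + m * (N - 1 - k)), pow_add _ a, ← pow_mul]
    linear_combination -(X ^ a * X ^ (m * (N - 1 - k)) * X ^ (b + m * k)) * hCε
  rw [two_mul, prod_range_add, hA, hB] at key
  have hterm : ∀ i ∈ range (N + N + 1),
      gaussBinom (X ^ m : R⟦X⟧) (N + N) i * (X ^ m) ^ (i.choose 2) * (C ε * X ^ a) ^ i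
        * (X ^ (m * N)) ^ (N + N - i)
      = X ^ (m * N * N + (a * N + m * N.choose 2)) * (C ε ^ N *
        (gaussBinom (X ^ m) (2 * N) i * thetaTerm ε a b ((i : ℤ) - N))) := by
    intro i hi
    have hi' : i ≤ N + N := by have := mem_range.1 hi; omega
    have hC : (C ε : R⟦X⟧) ^ i = C ε ^ N * C (ε ^ ((i : ℤ) - N).natAbs) := by
      rw [← map_pow, ← map_pow, ← map_mul, ← pow_add]
      congr 1
      exact pow_eq_pow_of_mod_two hε (by omega)
    have hX : m * i.choose 2 + a * i + m * N * (N + N - i)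
        = m * N * N + (a * N + m * N.choose 2)
          + (a * triangular ((i : ℤ) - N) + b * triangular (-((i : ℤ) - N))) := by
      zify [hi']
      have c1 : ∀ n : ℕ, 2 * ((n.choose 2 : ℕ) : ℤ) = n * (n - 1) := by
        intro n
        have h2 : ((n.choose 2 : ℕ) : ℤ) * 2 = n * (n - 1) := by
          rw [Nat.choose_two_right]
          obtain _ | n := n
          · simp
          · rw [Nat.add_sub_cancel]
            have h3 : (n + 1) * n / 2 * 2 = (n + 1) * n := Nat.div_mul_cancel (by
              rw [mul_comm]; exact (Nat.even_mul_succ_self n).two_dvd)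
            have h4 : (((n + 1) * n / 2 : ℕ) : ℤ) * 2 = (n + 1) * n := by exact_mod_cast h3
            rw [h4]; push_cast; ring
        linarith
      have t1 := two_mul_triangular ((i : ℤ) - N)
      have t2 := two_mul_triangular (-((i : ℤ) - N))
      have hi2 := c1 i
      have hN2 := c1 N
      have hmz : (m : ℤ) = a + b := by rw [hm]; push_cast; ring
      rw [hmz]
      have h2 : (2 : ℤ) ≠ 0 := two_ne_zero
      apply mul_left_cancel₀ h2
      linear_combination ((a : ℤ) + b) * hi2 - ((a : ℤ) + b) * hN2 - a * t1 - b * t2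
    rw [thetaTerm, mul_pow, hC, two_mul]
    have hX' := congrArg (fun n => (X : R⟦X⟧) ^ n) hX
    simp only [pow_add _ _ (a * triangular _ + _), pow_add _ (m * i.choose 2 + a * i),
      pow_add _ (m * i.choose 2)] at hX'
    rw [← pow_mul, ← pow_mul, ← pow_mul]
    linear_combination gaussBinom (X ^ m : R⟦X⟧) (N + N) i * C ε ^ N
      * C (ε ^ ((i : ℤ) - N).natAbs) * hX'
  rw [sum_congr rfl hterm, ← mul_sum, ← mul_sum] at key
  rw [show C ε ^ N * X ^ (a * N + m * N.choose 2) * pochFin ε b m N *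
      (X ^ (m * N * N) * pochFin ε a m N) = X ^ (m * N * N + (a * N + m * N.choose 2)) *
        (C ε ^ N * (pochFin ε a m N * pochFin ε b m N)) by ring] at key
  have key2 := X_pow_mul_cancel key
  have hu : (C ε : R⟦X⟧) ^ N * C ε ^ N = 1 := by rw [← mul_pow, hCε, one_pow]
  rw [← two_mul] at key2
  linear_combination C ε ^ N * key2 + (∑ i ∈ range (2 * N + 1),
      gaussBinom (X ^ m) (2 * N) i * thetaTerm ε a b ((i : ℤ) - N) -
      pochFin ε a m N * pochFin ε b m N) * hu

/-- In the product formula `gaussBinom_mul` all three finite products agree with the infinite one up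
to order `K + 1`, because the first omitted factor has exponent at least `m * (K + 1)`; the unit can
then be cancelled. -/
theorem X_pow_dvd_gaussBinom_mul_sub_one {m : ℕ} (hm : 0 < m) {i j K : ℕ} (hi : K ≤ i)
    (hj : K ≤ j) :
    (X : R⟦X⟧) ^ (K + 1) ∣ gaussBinom (X ^ m) (i + j) i * poch (-1) m m - 1 := by
  have hfin (n : ℕ) : ∏ k ∈ range n, (1 - ((X : R⟦X⟧) ^ m) ^ (k + 1)) = pochFin (-1) m m n := by
    refine prod_congr rfl fun k _ => ?_
    rw [map_neg, map_one, ← pow_mul]; ring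
  have hd {n : ℕ} (hn : K ≤ n) : X ^ (K + 1) ∣ poch (-1 : R) m m - pochFin (-1) m m n := by
    have h1 := X_pow_dvd_poch_sub (-1 : R) m hm (le_refl (K + 1))
    have h2 : X ^ (K + 1) ∣ pochFin (-1 : R) m m (n + 1) - pochFin (-1) m m (K + 1) :=
      X_pow_dvd_pochFin_sub _ _ hm (by omega)
    have h3 : X ^ (K + 1) ∣ pochFin (-1 : R) m m (n + 1) - pochFin (-1) m m n := by
      rw [pochFin, prod_range_succ, ← pochFin, mul_add, mul_one, add_sub_cancel_left, ← mul_assoc]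
      refine Dvd.dvd.mul_left (pow_dvd_pow _ ?_) _
      nlinarith
    have := dvd_add (dvd_sub h1 h2) h3
    convert this using 1; ring
  have hg := gaussBinom_mul (X ^ m : R⟦X⟧) i j
  rw [hfin, hfin, hfin] at hg
  have hu := isUnit_poch (-1 : R) hm m
  rw [← hu.dvd_mul_left]
  have h1 := dvd_mul_sub_mul (hd hi) (hd hj)
  have h2 := hd (show K ≤ i + j by omega)
  have h3 := dvd_sub (Dvd.dvd.mul_left h1 (gaussBinom (X ^ m) (i + j) i)) h2
  convert h3 using 1
  linear_combination hg

/-- The Jacobi triple product. -/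
theorem X_pow_dvd_theta_sub {ε : R} (hε : ε * ε = 1) {a : ℕ} (ha : 0 < a) (b N : ℕ) :
    X ^ N ∣ theta ε a b - ∑ j ∈ Icc (-(N : ℤ)) N, thetaTerm ε a b j := by
  have hm : 0 < a + b := by omega
  have h1 : X ^ N ∣ theta ε a b - pochFin ε a (a + b) N * pochFin ε b (a + b) N *
      poch (-1) (a + b) (a + b) := by
    rw [theta]
    exact dvd_mul_sub_mul (dvd_mul_sub_mul (X_pow_dvd_poch_sub _ _ hm le_rfl)
      (X_pow_dvd_poch_sub _ _ hm le_rfl)) (by simp)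
  rw [pochFin_mul_pochFin hε, sum_mul] at h1
  rw [← sum_range_eq_sum_Icc]
  have h2 : X ^ N ∣ ∑ i ∈ range (2 * N + 1), gaussBinom (X ^ (a + b)) (2 * N) i *
        thetaTerm ε a b ((i : ℤ) - N) * poch (-1) (a + b) (a + b) -
      ∑ i ∈ range (2 * N + 1), thetaTerm ε a b ((i : ℤ) - N) := by
    rw [← sum_sub_distrib]
    refine dvd_sum fun i hi => ?_
    have hi' : i < 2 * N + 1 := mem_range.1 hi
    have hg := X_pow_dvd_gaussBinom_mul_sub_one (R := R) hm (i := i) (j := 2 * N - i)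
      (K := min i (2 * N - i)) (by omega) (by omega)
    rw [show i + (2 * N - i) = 2 * N by omega] at hg
    set j : ℤ := (i : ℤ) - N with hj
    -- Only the summand with `a` is used, as `b` may be zero. For negative `j` the triangular number
    -- is |j|(|j| - 1)/2, whence the loss of one. The Gaussian coefficient supplies the missing
    -- order N - |j| + 1.
    have ht : X ^ (j.natAbs - 1) ∣ thetaTerm ε a b j := by
      refine Dvd.dvd.mul_left (pow_dvd_pow _ ?_) _
      have t := two_mul_triangular j
      have h3 : j.natAbs - 1 ≤ triangular j := by
        zify
        rcases lt_trichotomy j 0 with h | h | h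
        · rw [Nat.cast_sub (by omega)]
          push_cast
          rw [abs_of_neg h]
          nlinarith
        · simp [h]
        · rw [Nat.cast_sub (by omega)]
          push_cast
          rw [abs_of_pos h]
          nlinarith
      nlinarith
    have h4 := mul_dvd_mul hg ht
    rw [← pow_add] at h4
    have h5 := (pow_dvd_pow (X : R⟦X⟧) (show N ≤ min i (2 * N - i) + 1 + (j.natAbs - 1) by
      omega)).trans h4
    convert h5 using 1; ring
  have := dvd_add h1 h2
  convert this using 1; ring

end JacobiTripleProduct

/-! ### 3-dissections of theta series -/

section Dissection

variable {R : Type*} [CommRing R]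

/-- With the residues 0, 1, -1 mod 3, a symmetric range splits into three symmetric ranges. -/
theorem sum_Icc_three {S : Type*} [AddCommMonoid S] (t : ℤ → S) (N : ℕ) :
    ∑ j ∈ Icc (-((3 * N + 1 : ℕ) : ℤ)) (3 * N + 1 : ℕ), t j =
      ∑ i ∈ Icc (-(N : ℤ)) N, (t (3 * i) + t (3 * i + 1) + t (3 * i - 1)) := by
  rw [← sum_range_eq_sum_Icc, ← sum_range_eq_sum_Icc]
  have key (h : ℕ → S) (K : ℕ) : ∑ i ∈ range (3 * K), h i =
      ∑ i ∈ range K, (h (3 * i) + h (3 * i + 1) + h (3 * i + 2)) := by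
    induction K with
    | zero => simp
    | succ K ih =>
      rw [sum_range_succ, ← ih, show 3 * (K + 1) = 3 * K + 1 + 1 + 1 by ring, sum_range_succ,
        sum_range_succ, sum_range_succ, add_assoc, add_assoc, add_assoc]
  rw [show 2 * (3 * N + 1) + 1 = 3 * (2 * N + 1) by ring, key]
  refine sum_congr rfl fun i _ => ?_
  rw [add_rotate]
  refine congrArg₂ (· + ·) (congrArg₂ (· + ·) (congrArg t ?_) (congrArg t ?_)) (congrArg t ?_) <;>
    (push_cast; ring)

theorem theta_eq_of_three_dissection {ε : R} (hε : ε * ε = 1) {a : ℕ} (ha : 0 < a) (b : ℕ)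
    {S : R⟦X⟧}
    (h : ∀ N : ℕ, X ^ N ∣ S - ∑ i ∈ Icc (-(N : ℤ)) N, (thetaTerm ε a b (3 * i)
      + thetaTerm ε a b (3 * i + 1) + thetaTerm ε a b (3 * i - 1))) : theta ε a b = S := by
  refine eq_of_forall_X_pow_dvd_sub fun N => ?_
  have h1 := X_pow_dvd_theta_sub hε ha b (3 * N + 1)
  rw [sum_Icc_three] at h1
  have h2 := dvd_sub ((pow_dvd_pow (X : R⟦X⟧) (show N ≤ 3 * N + 1 by omega)).trans h1) (h N)
  rwa [sub_sub_sub_cancel_right] at h2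

/-- The substitution `q ↦ q ^ 3`. -/
noncomputable abbrev cubeVar : R⟦X⟧ →ₐ[R] R⟦X⟧ := expand 3 three_ne_zero

theorem cubeVar_injective : Function.Injective (cubeVar (R := R)) := by
  intro F G h
  ext n
  have := congrArg (coeff (3 * n)) h
  rwa [coeff_expand_mul, coeff_expand_mul] at this

theorem X_pow_dvd_cubeVar_sub {F G : R⟦X⟧} {N : ℕ} (h : X ^ N ∣ F - G) :
    X ^ N ∣ cubeVar F - cubeVar G := by
  have := map_dvd (cubeVar (R := R)) h
  rw [map_pow, expand_X, ← pow_mul, map_sub] at this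
  exact (pow_dvd_pow _ (by omega)).trans this

theorem cubeVar_C_mul_X_pow (c : R) (n : ℕ) :
    cubeVar (C c * X ^ n) = C c * X ^ (3 * n) := by
  rw [map_mul, expand_C, map_pow _ X, expand_X, ← pow_mul]

theorem cubeVar_thetaTerm (ε : R) (a b : ℕ) (j : ℤ) :
    cubeVar (thetaTerm ε a b j)
      = C (ε ^ j.natAbs) * X ^ (3 * (a * triangular j + b * triangular (-j))) := by
  rw [thetaTerm, cubeVar_C_mul_X_pow]

/-- The 3-dissection of `φ(-q)`. -/
theorem theta_neg_one_one_one :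
    theta (-1 : R) 1 1 = cubeVar (cubeVar (theta (-1) 1 1)) - 2 * X * cubeVar (theta (-1) 1 5) := by
  have hε : (-1 : R) * -1 = 1 := by ring
  refine theta_eq_of_three_dissection hε one_pos 1 fun N => ?_
  have h0 := X_pow_dvd_cubeVar_sub (X_pow_dvd_cubeVar_sub
    (X_pow_dvd_theta_sub hε one_pos 1 N))
  have h1 := X_pow_dvd_cubeVar_sub (X_pow_dvd_theta_sub hε one_pos 5 N)
  have h2 := X_pow_dvd_cubeVar_sub (X_pow_dvd_theta_sub hε (show 0 < 5 by norm_num) 1 N)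
  have h3 := dvd_sub h0 (Dvd.dvd.mul_left (dvd_add h1 h2) X)
  -- The exponents j² at j = 3i and j = 3i ± 1 are 9i² and 9i² ± 6i + 1. The two outer classes give
  -- the same theta function with its arguments swapped, which produces the coefficient 2.
  have hsum : ∑ i ∈ Icc (-(N : ℤ)) N, (thetaTerm (-1 : R) 1 1 (3 * i)
      + thetaTerm (-1) 1 1 (3 * i + 1) + thetaTerm (-1) 1 1 (3 * i - 1))
      = cubeVar (cubeVar (∑ i ∈ Icc (-(N : ℤ)) N, thetaTerm (-1) 1 1 i))
        - X * (cubeVar (∑ i ∈ Icc (-(N : ℤ)) N, thetaTerm (-1) 1 5 i)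
          + cubeVar (∑ i ∈ Icc (-(N : ℤ)) N, thetaTerm (-1) 5 1 i)) := by
    simp only [map_sum, mul_add, mul_sum]
    rw [← sum_add_distrib, ← sum_sub_distrib]
    refine sum_congr rfl fun i _ => ?_
    have t := two_mul_triangular i
    have t' := two_mul_triangular (-i)
    have e0 : thetaTerm (-1 : R) 1 1 (3 * i) = cubeVar (cubeVar (thetaTerm (-1) 1 1 i)) := by
      rw [cubeVar_thetaTerm, cubeVar_C_mul_X_pow, thetaTerm]
      have s := two_mul_triangular (3 * i)
      have s' := two_mul_triangular (-(3 * i))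
      congr 2
      · exact pow_eq_pow_of_mod_two hε (by omega)
      · zify; linarith
    have e1 : thetaTerm (-1 : R) 1 1 (3 * i + 1) = - (X * cubeVar (thetaTerm (-1) 5 1 i)) := by
      rw [cubeVar_thetaTerm, thetaTerm]
      have s := two_mul_triangular (3 * i + 1)
      have s' := two_mul_triangular (-(3 * i + 1))
      have : 1 * triangular (3 * i + 1) + 1 * triangular (-(3 * i + 1))
          = 3 * (5 * triangular i + 1 * triangular (-i)) + 1 := by zify; linarith
      rw [this, pow_eq_pow_of_mod_two hε (show (3 * i + 1).natAbs % 2 = (i.natAbs + 1) % 2 by omega)]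
      simp only [pow_succ, map_mul, map_neg, map_one]
      ring
    have e2 : thetaTerm (-1 : R) 1 1 (3 * i - 1) = - (X * cubeVar (thetaTerm (-1) 1 5 i)) := by
      rw [cubeVar_thetaTerm, thetaTerm]
      have s := two_mul_triangular (3 * i - 1)
      have s' := two_mul_triangular (-(3 * i - 1))
      have : 1 * triangular (3 * i - 1) + 1 * triangular (-(3 * i - 1))
          = 3 * (1 * triangular i + 5 * triangular (-i)) + 1 := by zify; linarith
      rw [this, pow_eq_pow_of_mod_two hε (show (3 * i - 1).natAbs % 2 = (i.natAbs + 1) % 2 by omega)]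
      simp only [pow_succ, map_mul, map_neg, map_one]
      ring
    rw [e0, e1, e2]; ring
  rw [hsum]
  rw [theta_comm (-1) 5 1] at h3
  convert h3 using 1; ring

/-- The 3-dissection of `2 ψ(q)`. -/
theorem theta_one_one_zero :
    theta (1 : R) 1 0 = 2 * cubeVar (theta 1 1 2) + X * cubeVar (cubeVar (theta 1 1 0)) := by
  have hε : (1 : R) * 1 = 1 := by ring
  refine theta_eq_of_three_dissection hε one_pos 0 fun N => ?_
  have h0 := X_pow_dvd_cubeVar_sub (X_pow_dvd_cubeVar_sub
    (X_pow_dvd_theta_sub hε one_pos 0 N))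
  have h1 := X_pow_dvd_cubeVar_sub (X_pow_dvd_theta_sub hε one_pos 2 N)
  have h2 := X_pow_dvd_cubeVar_sub (X_pow_dvd_theta_sub hε (show 0 < 2 by norm_num) 1 N)
  have h3 := dvd_add (dvd_add h1 h2) (Dvd.dvd.mul_left h0 X)
  -- For exponents j(j + 1)/2 it is the class j = 3i + 1 that reproduces the series, at q⁹ and with
  -- a factor q; the other two classes both give f(q³, q⁶).
  have hsum : ∑ i ∈ Icc (-(N : ℤ)) N, (thetaTerm (1 : R) 1 0 (3 * i)
      + thetaTerm 1 1 0 (3 * i + 1) + thetaTerm 1 1 0 (3 * i - 1))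
      = cubeVar (∑ i ∈ Icc (-(N : ℤ)) N, thetaTerm 1 1 2 i)
          + cubeVar (∑ i ∈ Icc (-(N : ℤ)) N, thetaTerm 1 2 1 i)
          + X * cubeVar (cubeVar (∑ i ∈ Icc (-(N : ℤ)) N, thetaTerm 1 1 0 i)) := by
    simp only [map_sum, mul_sum]
    rw [← sum_add_distrib, ← sum_add_distrib]
    refine sum_congr rfl fun i _ => ?_
    have t := two_mul_triangular i
    have t' := two_mul_triangular (-i)
    have e0 : thetaTerm (1 : R) 1 0 (3 * i) = cubeVar (thetaTerm 1 2 1 i) := by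
      rw [cubeVar_thetaTerm, thetaTerm]
      have s := two_mul_triangular (3 * i)
      rw [one_pow, one_pow]
      congr 2
      zify; linarith
    have e1 : thetaTerm (1 : R) 1 0 (3 * i + 1) = X * cubeVar (cubeVar (thetaTerm 1 1 0 i)) := by
      rw [cubeVar_thetaTerm, cubeVar_C_mul_X_pow, thetaTerm]
      have s := two_mul_triangular (3 * i + 1)
      have : 1 * triangular (3 * i + 1) + 0 * triangular (-(3 * i + 1))
          = 3 * (3 * (1 * triangular i + 0 * triangular (-i))) + 1 := by zify; linarith
      rw [this, one_pow, one_pow]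
      ring
    have e2 : thetaTerm (1 : R) 1 0 (3 * i - 1) = cubeVar (thetaTerm 1 1 2 i) := by
      rw [cubeVar_thetaTerm, thetaTerm]
      have s := two_mul_triangular (3 * i - 1)
      rw [one_pow, one_pow]
      congr 2
      zify; linarith
    rw [e0, e1, e2]; ring
  rw [hsum]
  rw [theta_comm 1 2 1] at h3
  convert h3 using 1; ring

end Dissection

/-! ### Theta functions as quotients of Euler products -/

section EtaQuotients

/-- The product `f_r = ∏_{n ≥ 1} (1 - q ^ (r n))` over a commutative ring `R`. -/
noncomputable def eulerProd (R : Type*) [CommRing R] (r : ℕ) : R⟦X⟧ := poch (-1) r r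

variable {R : Type*} [CommRing R]

theorem isUnit_eulerProd {r : ℕ} (hr : 0 < r) : IsUnit (eulerProd R r) := isUnit_poch _ hr _

theorem constantCoeff_eulerProd {r : ℕ} (hr : 0 < r) : constantCoeff (eulerProd R r) = 1 :=
  constantCoeff_poch _ hr _

theorem expand_eulerProd {r s : ℕ} (hr : 0 < r) (hs : s ≠ 0) :
    expand s hs (eulerProd R r) = eulerProd R (s * r) := expand_poch _ _ hr _

theorem map_eulerProd {S : Type*} [CommRing S] (g : R →+* S) {r : ℕ} (hr : 0 < r) :
    PowerSeries.map g (eulerProd R r) = eulerProd S r := by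
  rw [eulerProd, map_poch g _ _ hr, map_neg, map_one, eulerProd]

theorem poch_one_mul_eulerProd {r : ℕ} (hr : 0 < r) :
    poch (1 : R) r r * eulerProd R r = eulerProd R (2 * r) := by
  rw [eulerProd, poch_mul_poch_neg _ _ hr, one_pow, eulerProd]

theorem poch_neg_one_mul_eulerProd :
    poch (-1 : R) 1 2 * eulerProd R 2 = eulerProd R 1 := by
  rw [eulerProd, eulerProd, poch_split (-1 : R) 1 (k := 2) one_pos two_pos]
  simp [prod_range_succ]

theorem poch_two_four_mul : poch (-1 : R) 2 4 * eulerProd R 4 = eulerProd R 2 := by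
  rw [eulerProd, eulerProd, poch_split (-1 : R) 2 (k := 2) two_pos two_pos]
  simp [prod_range_succ]

theorem poch_one_one_two_mul :
    poch (1 : R) 1 2 * eulerProd R 1 * eulerProd R 4 = eulerProd R 2 ^ 2 := by
  have h2 := poch_mul_poch_neg (1 : R) 1 (m := 2) two_pos
  have h3 := poch_two_four_mul (R := R)
  norm_num at h2
  linear_combination (-poch (1 : R) 1 2 * eulerProd R 4) * poch_neg_one_mul_eulerProd (R := R)
    + eulerProd R 2 * eulerProd R 4 * h2 + eulerProd R 2 * h3

theorem theta_neg_one_one_one_mul :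
    theta (-1 : R) 1 1 * eulerProd R 2 = eulerProd R 1 ^ 2 := by
  rw [← poch_neg_one_mul_eulerProd, theta, eulerProd]; ring

/-- Split all products into residue classes mod 6; both sides then consist of the same factors. -/
theorem theta_neg_one_one_five_mul :
    theta (-1 : R) 1 5 * (eulerProd R 2 * eulerProd R 3) = eulerProd R 1 * eulerProd R 6 ^ 2 := by
  rw [theta, eulerProd, eulerProd, eulerProd, eulerProd,
    poch_split (-1 : R) 1 (k := 6) one_pos (by norm_num),
    poch_split (-1 : R) 2 (k := 3) two_pos (by norm_num),
    poch_split (-1 : R) 3 (k := 2) three_pos (by norm_num)]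
  simp only [prod_range_succ, prod_range_zero, one_mul]
  norm_num
  ring

theorem theta_one_one_zero_mul :
    theta (1 : R) 1 0 * eulerProd R 1 = 2 * eulerProd R 2 ^ 2 := by
  have h : poch (1 : R) 0 1 = 2 * poch 1 1 1 := by
    symm
    -- The extra factor is the one at exponent 0, equal to 1 + 1; it is the source of the 2.
    refine eq_poch _ _ one_pos fun N => ⟨N + 1, by omega, ?_⟩
    have e : pochFin (1 : R) 0 1 (N + 1) = 2 * pochFin 1 1 1 N := by
      rw [pochFin, prod_range_succ', pochFin, mul_comm]
      congr 1
      · norm_num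
      · exact prod_congr rfl fun k _ => by ring
    rw [e, ← mul_sub]
    exact Dvd.dvd.mul_left (X_pow_dvd_poch_sub _ _ one_pos le_rfl) _
  have h1 := poch_one_mul_eulerProd (R := R) one_pos
  have h2 : theta (1 : R) 1 0 = 2 * poch 1 1 1 * (poch 1 1 1 * eulerProd R 1) := by
    rw [theta, add_zero, h, eulerProd]; ring
  rw [mul_one] at h1
  rw [h2, h1]
  linear_combination 2 * eulerProd R 2 * h1

theorem theta_one_one_two_mul :
    theta (1 : R) 1 2 * (eulerProd R 1 * eulerProd R 6) = eulerProd R 2 * eulerProd R 3 ^ 2 := by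
  have h1 := poch_one_mul_eulerProd (R := R) one_pos
  have h3 := poch_one_mul_eulerProd (R := R) three_pos
  have hs := poch_split (1 : R) 1 (k := 3) one_pos three_pos
  simp only [prod_range_succ, prod_range_zero, one_mul] at hs
  norm_num at hs h1 h3
  have ht : theta (1 : R) 1 2 = poch 1 1 3 * poch 1 2 3 * eulerProd R 3 := rfl
  rw [ht, ← h1, ← h3, hs]
  ring

end EtaQuotients

/-! ### Norms under q ↦ ωq -/

section CubicNorm

variable {K : Type*} [Field K]

/-- The product of the conjugates of a power series under `q ↦ ω q`. -/
noncomputable def cubicNorm (w : K) (F : K⟦X⟧) : K⟦X⟧ :=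
  F * rescale w F * rescale (w ^ 2) F

theorem cubicNorm_mul (w : K) (F G : K⟦X⟧) :
    cubicNorm w (F * G) = cubicNorm w F * cubicNorm w G := by
  simp only [cubicNorm, map_mul]; ring

theorem rescale_cubeVar {w : K} (hw : w ^ 3 = 1) (F : K⟦X⟧) :
    rescale w (cubeVar F) = cubeVar F := by
  ext n
  rw [coeff_rescale, coeff_expand]
  split_ifs with h
  · obtain ⟨k, rfl⟩ := h
    rw [pow_mul, hw, one_pow, one_mul]
  · rw [mul_zero]

/-- Series in q³ are fixed by the conjugations, so this is the factorization of u³ + v³ over the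
cube roots of unity. -/
theorem cubicNorm_linear {w : K} (hw : 1 + w + w ^ 2 = 0) (F G : K⟦X⟧) :
    cubicNorm w (cubeVar F + X * cubeVar G) = cubeVar (F ^ 3 + X * G ^ 3) := by
  have h3 : w ^ 3 = 1 := by linear_combination (w - 1) * hw
  have h6 : (w ^ 2) ^ 3 = 1 := by linear_combination (w ^ 3 + 1) * h3
  have hC : 1 + C w + C w ^ 2 = (0 : K⟦X⟧) := by
    rw [← map_pow, ← map_one (C (R := K)), ← map_add, ← map_add, hw, map_zero]
  simp only [cubicNorm, map_add, map_mul, map_pow, rescale_cubeVar h3, rescale_cubeVar h6,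
    rescale_X, expand_X]
  linear_combination (cubeVar F ^ 2 * X * cubeVar G + cubeVar F * X ^ 2 * cubeVar G ^ 2 * C w +
    X ^ 3 * cubeVar G ^ 3 * (C w - 1)) * hC

/-- A factor 1 - qⁿ has norm 1 - q³ⁿ if 3 ∤ n and (1 - qⁿ)³ if 3 ∣ n. As 3 ∤ r, the first kind
contributes f_{3r}/f_{9r} and the second f_{3r}³. -/
theorem cubicNorm_eulerProd {w : K} (hw : 1 + w + w ^ 2 = 0) {r : ℕ} (hr : r % 3 ≠ 0) :
    cubicNorm w (eulerProd K r) * eulerProd K (9 * r) = eulerProd K (3 * r) ^ 4 := by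
  have h3 : w ^ 3 = 1 := by linear_combination (w - 1) * hw
  have h3r : w ^ (3 * r) = 1 := by rw [pow_mul, h3, one_pow]
  have h6r : (w ^ 2) ^ (3 * r) = 1 := by rw [← pow_mul, mul_comm, pow_mul, h3r, one_pow]
  have hr0 : 0 < r := by omega
  have hm : 0 < 3 * r := by omega
  have hC : 1 + C w + C w ^ 2 = (0 : K⟦X⟧) := by
    rw [← map_pow, ← map_one (C (R := K)), ← map_add, ← map_add, hw, map_zero]
  have key (a : ℕ) (ha : a % 3 ≠ 0) : cubicNorm w (poch (-1) a (3 * r))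
      = poch (-1) (3 * a) (9 * r) := by
    rw [cubicNorm, rescale_poch _ _ _ hm h3r, rescale_poch _ _ _ hm h6r]
    refine eq_poch _ _ (by omega) fun N => ⟨N, le_rfl, ?_⟩
    have e : pochFin (-1 : K) (3 * a) (9 * r) N = pochFin (-1) a (3 * r) N *
        pochFin (-1 * w ^ a) a (3 * r) N * pochFin (-1 * (w ^ 2) ^ a) a (3 * r) N := by
      rw [pochFin, pochFin, pochFin, pochFin, ← prod_mul_distrib, ← prod_mul_distrib]
      refine prod_congr rfl fun k _ => ?_
      have hwa : 1 + w ^ a + (w ^ a) ^ 2 = 0 := by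
        rw [← Nat.mod_add_div a 3, pow_add, pow_mul, h3, one_pow, mul_one]
        have : a % 3 < 3 := Nat.mod_lt _ three_pos
        obtain h | h : a % 3 = 1 ∨ a % 3 = 2 := by omega
        · rw [h]; linear_combination hw
        · rw [h]; linear_combination hw + w * h3
      have hCa : 1 + C (w ^ a) + C (w ^ a) ^ 2 = (0 : K⟦X⟧) := by
        rw [← map_pow, ← map_one (C (R := K)), ← map_add, ← map_add, hwa, map_zero]
      have hp : (X : K⟦X⟧) ^ (3 * a + 9 * r * k) = (X ^ (a + 3 * r * k)) ^ 3 := by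
        rw [← pow_mul]; congr 1; ring
      rw [hp, show (w ^ 2) ^ a = (w ^ a) ^ 2 by rw [← pow_mul, ← pow_mul, mul_comm]]
      simp only [map_mul, map_neg, map_one, map_pow (C (R := K)) _ 2]
      generalize C (w ^ a) = z at hCa
      generalize (X : K⟦X⟧) ^ (a + 3 * r * k) = t
      linear_combination (t - z * t ^ 2 + (z - 1) * t ^ 3) * hCa
    rw [e]
    exact dvd_mul_sub_mul (dvd_mul_sub_mul (X_pow_dvd_poch_sub _ _ hm le_rfl)
      (X_pow_dvd_poch_sub _ _ hm le_rfl)) (X_pow_dvd_poch_sub _ _ hm le_rfl)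
  have hs := poch_split (-1 : K) r (k := 3) hr0 three_pos
  have hs' := poch_split (-1 : K) (3 * r) (k := 3) hm three_pos
  simp only [prod_range_succ, prod_range_zero, one_mul, mul_zero, add_zero, mul_one] at hs hs'
  rw [show 3 * (3 * r) = 9 * r by ring, show 3 * r + 3 * r = 3 * (2 * r) by ring,
    show 3 * r + 3 * r * 2 = 9 * r by ring] at hs'
  rw [show r + r = 2 * r by ring, show r + r * 2 = 3 * r by ring] at hs
  have h1 : cubicNorm w (eulerProd K (3 * r)) = eulerProd K (3 * r) ^ 3 := by
    rw [cubicNorm, ← expand_eulerProd hr0 three_ne_zero, rescale_cubeVar h3, rescale_cubeVar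
      (by rw [← pow_mul, mul_comm, pow_mul, h3, one_pow])]
    ring
  have h2 : cubicNorm w (eulerProd K r) = poch (-1) (3 * r) (9 * r) *
      poch (-1) (3 * (2 * r)) (9 * r) * eulerProd K (3 * r) ^ 3 := by
    rw [← key r hr, ← key (2 * r) (by omega), ← h1, ← cubicNorm_mul, ← cubicNorm_mul]
    exact congrArg _ hs
  rw [h2]
  have h4 : eulerProd K (3 * r) = poch (-1) (3 * r) (9 * r) *
      poch (-1) (3 * (2 * r)) (9 * r) * eulerProd K (9 * r) := hs'
  linear_combination (-eulerProd K (3 * r) ^ 3) * h4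

end CubicNorm

/-! ### Generating functions of the partition counts -/

section GeneratingFunctions

open Filter Topology

theorem tendsto_of_X_pow_dvd_sub {F : ℚ⟦X⟧} {G : ℕ → ℚ⟦X⟧}
    (h : ∀ N M, N ≤ M → X ^ N ∣ F - G M) : Tendsto G atTop (𝓝 F) := by
  rw [WithPiTopology.tendsto_iff_coeff_tendsto]
  intro d
  refine tendsto_const_nhds.congr' (eventually_atTop.2 ⟨d + 1, fun M hM => ?_⟩)
  have := X_pow_dvd_iff.1 (h (d + 1) M hM) d (Nat.lt_succ_self d)
  rwa [map_sub, sub_eq_zero] at this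

theorem tendsto_pochFin (c : ℚ) (a : ℕ) {m : ℕ} (hm : 0 < m) :
    Tendsto (pochFin c a m) atTop (𝓝 (poch c a m)) :=
  tendsto_of_X_pow_dvd_sub fun _ _ h => X_pow_dvd_poch_sub c a hm h

theorem tendsto_two_mul_atTop : Tendsto (fun M : ℕ => 2 * M) atTop atTop :=
  tendsto_id.const_mul_atTop' two_pos

theorem fq_eq_eulerProd {r : ℕ} (hr : 0 < r) : fq r = eulerProd ℚ r := by
  refine tendsto_nhds_unique (fq_multipliable hr).hasProd.tendsto_prod_nat ?_
  refine (tendsto_pochFin (-1) r hr).congr fun N => ?_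
  refine prod_congr rfl fun k _ => ?_
  rw [map_neg, map_one]; ring

theorem prod_range_two_mul {S : Type*} [CommMonoid S] (u : ℕ → S) (M : ℕ) :
    ∏ i ∈ range (2 * M), u i = ∏ k ∈ range M, (u (2 * k) * u (2 * k + 1)) := by
  induction M with
  | zero => simp
  | succ M ih =>
    rw [prod_range_succ, ← ih, show 2 * (M + 1) = 2 * M + 1 + 1 by ring, prod_range_succ,
      prod_range_succ, mul_assoc]

/-- The factor of the part size `i + 1` in the generating function of the weight `f`. -/
noncomputable def partFactor (f : ℕ → ℕ → ℚ) (i : ℕ) : ℚ⟦X⟧ :=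
  1 + ∑' j, f (i + 1) (j + 1) • X ^ ((i + 1) * (j + 1))

/-- Products are cut off after an even number of factors so that odd and even part sizes can be
paired. -/
theorem genFun_mul_eq {f : ℕ → ℕ → ℚ} {u v : ℕ → ℚ⟦X⟧} {U V : ℚ⟦X⟧}
    (h : ∀ i, partFactor f i * u i = v i)
    (hU : Tendsto (fun M => ∏ i ∈ range (2 * M), u i) atTop (𝓝 U))
    (hV : Tendsto (fun M => ∏ i ∈ range (2 * M), v i) atTop (𝓝 V)) :
    Nat.Partition.genFun f * U = V := by
  have hG := (Nat.Partition.hasProd_genFun f).tendsto_prod_nat.comp tendsto_two_mul_atTop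
  refine tendsto_nhds_unique ((hG.mul hU).congr fun M => ?_) hV
  rw [Function.comp_apply, ← prod_mul_distrib]
  exact prod_congr rfl fun i _ => h i

/-- Geometric series: (1 + cx/(1 - x))(1 - x) = 1 + (c - 1)x. The value c = 1 gives unrestricted
parts, c = 2 overpartitions. -/
theorem partFactor_mul_of_const {f : ℕ → ℕ → ℚ} {i : ℕ} {c : ℚ} (h : ∀ j, f (i + 1) (j + 1) = c) :
    partFactor f i * (1 - X ^ (i + 1)) = 1 + C (c - 1) * X ^ (i + 1) := by
  have h0 : (constantCoeff (X ^ (i + 1) : ℚ⟦X⟧)) = 0 := by simp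
  have hs := WithPiTopology.summable_pow_of_constantCoeff_eq_zero h0
  have hg := WithPiTopology.tsum_pow_mul_one_sub_of_constantCoeff_eq_zero h0
  have e : ∑' j, f (i + 1) (j + 1) • (X : ℚ⟦X⟧) ^ ((i + 1) * (j + 1))
      = C c * X ^ (i + 1) * ∑' j, (X ^ (i + 1)) ^ j := by
    rw [← hs.tsum_mul_left]
    refine tsum_congr fun j => ?_
    rw [h, smul_eq_C_mul, ← pow_mul, mul_assoc, ← pow_add]
    congr 2
    ring
  rw [partFactor, e, add_mul, mul_assoc, hg, map_sub, map_one]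
  ring

theorem partFactor_of_distinct {f : ℕ → ℕ → ℚ} {i : ℕ} (h1 : f (i + 1) 1 = 1)
    (h : ∀ j, 1 < j → f (i + 1) j = 0) : partFactor f i = 1 + X ^ (i + 1) := by
  rw [partFactor, tsum_eq_single 0]
  · simp [h1]
  · intro j hj
    rw [h (j + 1) (by omega), zero_smul]

theorem toFinsupp_prod_ite {n : ℕ} (p : n.Partition) (P : ℕ → ℕ → Prop)
    [∀ i c, Decidable (P i c)] (g : ℕ → ℕ → ℚ) :
    p.parts.toFinsupp.prod (fun i c => if P i c then g i c else 0) =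
      if ∀ i ∈ p.parts, P i (p.parts.count i) then
        ∏ i ∈ p.parts.toFinset, g i (p.parts.count i) else 0 := by
  have key (h : ℕ → ℕ → ℚ) : p.parts.toFinsupp.prod h
      = ∏ i ∈ p.parts.toFinset, h i (p.parts.count i) := by
    rw [Finsupp.prod, Multiset.toFinsupp_support]
    simp only [Multiset.toFinsupp_apply]
  rw [key, prod_ite_zero]
  simp only [Multiset.mem_toFinset]

theorem prod_range_one_sub_X_pow (M : ℕ) :
    ∏ i ∈ range M, (1 - X ^ (i + 1) : ℚ⟦X⟧) = pochFin (-1) 1 1 M := by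
  refine prod_congr rfl fun k _ => ?_
  rw [map_neg, map_one]; ring

theorem tendsto_prod_one_sub_X_pow :
    Tendsto (fun M => ∏ i ∈ range (2 * M), (1 - X ^ (i + 1) : ℚ⟦X⟧)) atTop
      (𝓝 (eulerProd ℚ 1)) := by
  refine ((tendsto_pochFin (-1) 1 one_pos).comp tendsto_two_mul_atTop).congr fun M => ?_
  rw [prod_range_one_sub_X_pow, Function.comp_apply]

theorem mk_ped_mul :
    (PowerSeries.mk fun n => (ped n : ℚ)) * eulerProd ℚ 1 = eulerProd ℚ 4 := by
  have hG : (PowerSeries.mk fun n => (ped n : ℚ)) =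
      Nat.Partition.genFun fun i c => if Even i → c = 1 then 1 else 0 := by
    ext n
    rw [coeff_mk, Nat.Partition.coeff_genFun]
    simp only [toFinsupp_prod_ite, prod_const_one, sum_boole, ped]
  rw [hG]
  refine genFun_mul_eq (u := fun i => 1 - X ^ (i + 1))
    (v := fun i => if Even (i + 1) then 1 - X ^ (2 * (i + 1)) else 1) (fun i => ?_)
    tendsto_prod_one_sub_X_pow ?_
  · split_ifs with h
    · rw [partFactor_of_distinct (by simp) (fun j hj => by simp [h, hj.ne'])]
      ring
    · rw [partFactor_mul_of_const (c := 1) (fun j => by simp [h])]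
      simp
  · refine (tendsto_pochFin (-1) 4 four_pos).congr fun M => ?_
    rw [prod_range_two_mul, pochFin]
    refine prod_congr rfl fun k _ => ?_
    rw [if_neg (by simp [parity_simps]), if_pos (by simp [parity_simps]), map_neg, map_one]
    ring

theorem mk_pod_mul :
    (PowerSeries.mk fun n => (pod n : ℚ)) * (eulerProd ℚ 1 * eulerProd ℚ 4) = eulerProd ℚ 2 := by
  have hG : (PowerSeries.mk fun n => (pod n : ℚ)) =
      Nat.Partition.genFun fun i c => if Odd i → c = 1 then 1 else 0 := by
    ext n
    rw [coeff_mk, Nat.Partition.coeff_genFun]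
    simp only [toFinsupp_prod_ite, prod_const_one, sum_boole, pod]
  have key : (PowerSeries.mk fun n => (pod n : ℚ)) * eulerProd ℚ 1 = poch (-1) 2 4 := by
    rw [hG]
    refine genFun_mul_eq (u := fun i => 1 - X ^ (i + 1))
      (v := fun i => if Odd (i + 1) then 1 - X ^ (2 * (i + 1)) else 1) (fun i => ?_)
      tendsto_prod_one_sub_X_pow ?_
    · split_ifs with h
      · rw [partFactor_of_distinct (by simp) (fun j hj => by simp [h, hj.ne'])]
        ring
      · rw [partFactor_mul_of_const (c := 1) (fun j => by simp [h])]
        simp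
    · refine (tendsto_pochFin (-1) 2 four_pos).congr fun M => ?_
      rw [prod_range_two_mul, pochFin]
      refine prod_congr rfl fun k _ => ?_
      rw [if_pos (by simp [parity_simps]), if_neg (by simp [parity_simps]), map_neg, map_one]
      ring
  rw [← mul_assoc, key, poch_two_four_mul]

/-- Each part size that occurs may be overlined or not, so it has weight 2 whatever its
multiplicity. -/
theorem mk_overp_mul :
    (PowerSeries.mk fun n => (overp n : ℚ)) * eulerProd ℚ 1 ^ 2 = eulerProd ℚ 2 := by
  have hG : (PowerSeries.mk fun n => (overp n : ℚ)) =
      Nat.Partition.genFun fun _ _ => 2 := by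
    ext n
    rw [coeff_mk, Nat.Partition.coeff_genFun, overp,
      Fintype.card_congr (Overpartition.equivSigma n), Fintype.card_sigma]
    push_cast
    refine sum_congr rfl fun p _ => ?_
    rw [Finsupp.prod, prod_const, Multiset.toFinsupp_support, Fintype.card_coe, card_powerset]
    norm_num
  have key : (PowerSeries.mk fun n => (overp n : ℚ)) * eulerProd ℚ 1 = poch 1 1 1 := by
    rw [hG]
    refine genFun_mul_eq (u := fun i => 1 - X ^ (i + 1))
      (v := fun i => 1 + X ^ (i + 1)) (fun i => ?_) tendsto_prod_one_sub_X_pow ?_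
    · rw [partFactor_mul_of_const (c := 2) (fun _ => rfl)]
      norm_num
    · refine ((tendsto_pochFin 1 1 one_pos).comp tendsto_two_mul_atTop).congr fun M => ?_
      rw [Function.comp_apply, pochFin]
      refine prod_congr rfl fun k _ => ?_
      rw [map_one]; ring
  have h := poch_one_mul_eulerProd (R := ℚ) one_pos
  rw [mul_one] at h
  rw [pow_two, ← mul_assoc, key, h]

theorem mk_overpOdd_mul :
    (PowerSeries.mk fun n => (overpOdd n : ℚ)) * (eulerProd ℚ 1 ^ 2 * eulerProd ℚ 4)
      = eulerProd ℚ 2 ^ 3 := by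
  have hG : (PowerSeries.mk fun n => (overpOdd n : ℚ)) =
      Nat.Partition.genFun fun i _ => if Odd i then 2 else 0 := by
    ext n
    rw [coeff_mk, Nat.Partition.coeff_genFun, overpOdd, card_filter,
      Fintype.sum_equiv (Overpartition.equivSigma n)
        (fun π => if ∀ i ∈ π.partition.parts, Odd i then 1 else 0)
        (fun x => if ∀ i ∈ x.1.parts, Odd i then 1 else 0) (fun _ => rfl), Fintype.sum_sigma]
    push_cast
    refine sum_congr rfl fun p _ => ?_
    rw [toFinsupp_prod_ite p (fun i _ => Odd i) (fun _ _ => 2), sum_const, card_univ,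
      Fintype.card_coe, card_powerset]
    split_ifs <;> simp
  have key : (PowerSeries.mk fun n => (overpOdd n : ℚ)) * poch (-1) 1 2 = poch 1 1 2 := by
    rw [hG]
    refine genFun_mul_eq (u := fun i => if Odd (i + 1) then 1 - X ^ (i + 1) else 1)
      (v := fun i => if Odd (i + 1) then 1 + X ^ (i + 1) else 1) (fun i => ?_) ?_ ?_
    · split_ifs with h
      · rw [partFactor_mul_of_const (c := 2) (fun j => by simp [h])]
        norm_num
      · rw [partFactor]; simp [h]
    · refine (tendsto_pochFin (-1) 1 two_pos).congr fun M => ?_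
      rw [prod_range_two_mul, pochFin]
      refine prod_congr rfl fun k _ => ?_
      rw [if_pos (by simp [parity_simps]), if_neg (by simp [parity_simps]), map_neg, map_one]
      ring
    · refine (tendsto_pochFin 1 1 two_pos).congr fun M => ?_
      rw [prod_range_two_mul, pochFin]
      refine prod_congr rfl fun k _ => ?_
      rw [if_pos (by simp [parity_simps]), if_neg (by simp [parity_simps]), map_one]
      ring
  have h1 := poch_neg_one_mul_eulerProd (R := ℚ)
  have h2 := poch_one_one_two_mul (R := ℚ)
  linear_combination (-(PowerSeries.mk fun n => (overpOdd n : ℚ)) * eulerProd ℚ 1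
    * eulerProd ℚ 4) * h1 + eulerProd ℚ 1 * eulerProd ℚ 2 * eulerProd ℚ 4 * key
    + eulerProd ℚ 2 * h2

end GeneratingFunctions

/-! ### Extraction of exponents in a class mod 3 -/

section Sections

variable {R : Type*} [CommRing R]

/-- The power series `∑ a_{3 n + k} q ^ n` extracted from `∑ a_n q ^ n`. -/
noncomputable def sect (k : ℕ) (F : R⟦X⟧) : R⟦X⟧ :=
  PowerSeries.mk fun n => coeff (3 * n + k) F

theorem coeff_X_pow_mul_cubeVar (F : R⟦X⟧) {j k : ℕ} (hj : j < 3) (hk : k < 3) (m : ℕ) :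
    coeff (3 * m + k) (X ^ j * cubeVar F) = if k = j then coeff m F else 0 := by
  rw [coeff_X_pow_mul', coeff_expand]
  split_ifs with h1 h2 h3 h3 h3
  · rw [show (3 * m + k - j) / 3 = m by omega]
  · omega
  · omega
  · rfl
  · omega
  · rfl

theorem sect_add (k : ℕ) (F G : R⟦X⟧) : sect k (F + G) = sect k F + sect k G := by
  ext n; simp [sect]

theorem sect_X_pow_mul_cubeVar (F : R⟦X⟧) {j k : ℕ} (hj : j < 3) (hk : k < 3) :
    sect k (X ^ j * cubeVar F) = if k = j then F else 0 := by
  ext n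
  rw [sect, coeff_mk, coeff_X_pow_mul_cubeVar F hj hk]
  split_ifs <;> simp

theorem sect_dissection (A B D : R⟦X⟧) {k : ℕ} (hk : k < 3) :
    sect k (cubeVar A + X * cubeVar B + X ^ 2 * cubeVar D) =
      (if k = 0 then A else 0) + (if k = 1 then B else 0) + (if k = 2 then D else 0) := by
  rw [← sect_X_pow_mul_cubeVar A (j := 0) three_pos hk,
    ← sect_X_pow_mul_cubeVar B (j := 1) (by norm_num) hk,
    ← sect_X_pow_mul_cubeVar D (j := 2) (by norm_num) hk, ← sect_add, ← sect_add, pow_zero,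
    one_mul, pow_one]

theorem eq_sum_sect (F : R⟦X⟧) :
    F = cubeVar (sect 0 F) + X * cubeVar (sect 1 F) + X ^ 2 * cubeVar (sect 2 F) := by
  ext n
  obtain ⟨m, k, hk, rfl⟩ : ∃ m k, k < 3 ∧ n = 3 * m + k :=
    ⟨n / 3, n % 3, Nat.mod_lt _ three_pos, (Nat.div_add_mod n 3).symm⟩
  have h0 := coeff_X_pow_mul_cubeVar (sect 0 F) (j := 0) three_pos hk m
  have h1 := coeff_X_pow_mul_cubeVar (sect 1 F) (j := 1) (by norm_num) hk m
  have h2 := coeff_X_pow_mul_cubeVar (sect 2 F) (j := 2) (by norm_num) hk m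
  rw [pow_zero, one_mul] at h0
  rw [pow_one] at h1
  rw [map_add, map_add, h0, h1, h2]
  interval_cases k <;> simp [sect]

theorem sect_cubeVar_mul {k : ℕ} (hk : k < 3) (G F : R⟦X⟧) :
    sect k (cubeVar G * F) = G * sect k F := by
  have e : cubeVar G * F = cubeVar (G * sect 0 F) + X * cubeVar (G * sect 1 F)
      + X ^ 2 * cubeVar (G * sect 2 F) := by
    conv_lhs => rw [eq_sum_sect F]
    simp only [map_mul]; ring
  rw [e, sect_dissection _ _ _ hk]
  interval_cases k <;> simp

end Sections

/-! ### Cubic identities for φ(-q) and ψ(q) -/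

section CubicIdentities

/-- Ramanujan's `ψ(q)` as a quotient of Euler products. -/
noncomputable def psi (K : Type*) [Field K] : K⟦X⟧ := eulerProd K 2 ^ 2 * (eulerProd K 1)⁻¹

variable {K : Type*} [Field K]

theorem psi_mul : psi K * eulerProd K 1 = eulerProd K 2 ^ 2 := by
  rw [psi, mul_assoc, PowerSeries.inv_mul_cancel, mul_one]
  rw [constantCoeff_eulerProd one_pos]
  exact one_ne_zero

theorem eulerProd_ne_zero {r : ℕ} (hr : 0 < r) : eulerProd K r ≠ 0 :=
  (isUnit_eulerProd hr).ne_zero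

theorem theta_one_one_zero_eq : theta (1 : K) 1 0 = 2 * psi K := by
  refine mul_right_cancel₀ (eulerProd_ne_zero one_pos) ?_
  rw [theta_one_one_zero_mul, mul_assoc, psi_mul]

theorem psi_dissection [CharZero K] :
    psi K = cubeVar (theta 1 1 2) + X * cubeVar (cubeVar (psi K)) := by
  have h := theta_one_one_zero (R := K)
  rw [theta_one_one_zero_eq, map_mul, map_mul, map_ofNat, map_ofNat] at h
  have h2 : (2 : K⟦X⟧) ≠ 0 := by
    intro h0
    have := congrArg constantCoeff h0
    rw [map_ofNat, map_zero] at this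
    exact two_ne_zero this
  refine mul_left_cancel₀ h2 ?_
  linear_combination h

theorem cubeVar_eulerProd {r : ℕ} (hr : 0 < r) :
    cubeVar (eulerProd K r) = eulerProd K (3 * r) := expand_eulerProd hr three_ne_zero

/-- Take the norm of φ(-q) = f_1²/f_2 twice, through the dissection and through the Euler products,
and undo q ↦ q³ by injectivity. -/
theorem phi_cubic_of_root {w : K} (hw : 1 + w + w ^ 2 = 0) :
    (cubeVar (theta (-1) 1 1) ^ 3 - 8 * X * theta (-1) 1 5 ^ 3) * cubeVar (theta (-1) 1 1)
      = theta (-1 : K) 1 1 ^ 4 := by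
  have hP := theta_neg_one_one_one_mul (R := K)
  have ha := congrArg cubeVar hP
  rw [map_mul, map_pow, cubeVar_eulerProd one_pos, cubeVar_eulerProd two_pos] at ha
  have hd : theta (-1 : K) 1 1 = cubeVar (cubeVar (theta (-1) 1 1))
      + X * cubeVar (-2 * theta (-1) 1 5) := by
    conv_lhs => rw [theta_neg_one_one_one]
    rw [map_mul, map_neg, map_ofNat]; ring
  have hN : cubicNorm w (theta (-1 : K) 1 1)
      = cubeVar (cubeVar (theta (-1) 1 1) ^ 3 - 8 * X * theta (-1) 1 5 ^ 3) := by
    conv_lhs => rw [hd]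
    rw [cubicNorm_linear hw]
    congr 1; ring
  have hm := congrArg (cubicNorm w) hP
  rw [pow_two, cubicNorm_mul, cubicNorm_mul, hN] at hm
  have h1 := cubicNorm_eulerProd hw (r := 1) (by norm_num)
  have h2 := cubicNorm_eulerProd hw (r := 2) (by norm_num)
  have key : (cubeVar (theta (-1) 1 1) ^ 3 - 8 * X * theta (-1) 1 5 ^ 3) *
      (eulerProd K 2 ^ 4 * eulerProd K 3 ^ 2) = eulerProd K 1 ^ 8 * eulerProd K 6 := by
    refine cubeVar_injective ?_
    rw [map_mul cubeVar (_ - _), map_mul cubeVar (_ ^ 4), map_mul cubeVar (_ ^ 8)]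
    simp only [map_pow cubeVar (eulerProd K _)]
    rw [cubeVar_eulerProd one_pos, cubeVar_eulerProd two_pos, cubeVar_eulerProd three_pos,
      cubeVar_eulerProd (by norm_num)]
    generalize cubeVar (cubeVar (theta (-1 : K) 1 1) ^ 3 - 8 * X * theta (-1) 1 5 ^ 3) = n at hm ⊢
    norm_num at h1 h2 ⊢
    rw [← h2]
    linear_combination (eulerProd K 18 * eulerProd K 9 ^ 2) * hm + eulerProd K 18 *
      (cubicNorm w (eulerProd K 1) * eulerProd K 9 + eulerProd K 3 ^ 4) * h1
  have hne : eulerProd K 2 ^ 4 * eulerProd K 6 ≠ 0 :=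
    mul_ne_zero (pow_ne_zero _ (eulerProd_ne_zero two_pos)) (eulerProd_ne_zero (by norm_num))
  refine mul_right_cancel₀ hne ?_
  norm_num at ha
  have hP4 : theta (-1 : K) 1 1 ^ 4 * eulerProd K 2 ^ 4 = eulerProd K 1 ^ 8 := by
    rw [← mul_pow, hP]; ring
  linear_combination key - eulerProd K 6 * hP4 + (cubeVar (theta (-1) 1 1) ^ 3
    - 8 * X * theta (-1) 1 5 ^ 3) * eulerProd K 2 ^ 4 * ha

theorem psi_cubic_of_root [CharZero K] {w : K} (hw : 1 + w + w ^ 2 = 0) :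
    (theta 1 1 2 ^ 3 + X * cubeVar (psi K) ^ 3) * cubeVar (psi K) = psi K ^ 4 := by
  have hP := psi_mul (K := K)
  have ha := congrArg cubeVar hP
  rw [map_mul, map_pow, cubeVar_eulerProd one_pos, cubeVar_eulerProd two_pos] at ha
  have hN : cubicNorm w (psi K) = cubeVar (theta 1 1 2 ^ 3 + X * cubeVar (psi K) ^ 3) := by
    conv_lhs => rw [psi_dissection]
    rw [cubicNorm_linear hw]
  have hm := congrArg (cubicNorm w) hP
  rw [pow_two, cubicNorm_mul, cubicNorm_mul, hN] at hm
  have h1 := cubicNorm_eulerProd hw (r := 1) (by norm_num)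
  have h2 := cubicNorm_eulerProd hw (r := 2) (by norm_num)
  have key : (theta 1 1 2 ^ 3 + X * cubeVar (psi K) ^ 3) *
      (eulerProd K 1 ^ 4 * eulerProd K 6 ^ 2) = eulerProd K 2 ^ 8 * eulerProd K 3 := by
    refine cubeVar_injective ?_
    rw [map_mul cubeVar (_ + _), map_mul cubeVar (_ ^ 4), map_mul cubeVar (_ ^ 8)]
    simp only [map_pow cubeVar (eulerProd K _)]
    rw [cubeVar_eulerProd one_pos, cubeVar_eulerProd two_pos, cubeVar_eulerProd three_pos,
      cubeVar_eulerProd (by norm_num)]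
    generalize cubeVar (theta 1 1 2 ^ 3 + X * cubeVar (psi K) ^ 3) = n at hm ⊢
    norm_num at h1 h2 ⊢
    rw [← h1]
    linear_combination (eulerProd K 9 * eulerProd K 18 ^ 2) * hm + eulerProd K 9 *
      (cubicNorm w (eulerProd K 2) * eulerProd K 18 + eulerProd K 6 ^ 4) * h2
  have hne : eulerProd K 1 ^ 4 * eulerProd K 3 ≠ 0 :=
    mul_ne_zero (pow_ne_zero _ (eulerProd_ne_zero one_pos)) (eulerProd_ne_zero (by norm_num))
  refine mul_right_cancel₀ hne ?_
  norm_num at ha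
  have hP4 : psi K ^ 4 * eulerProd K 1 ^ 4 = eulerProd K 2 ^ 8 := by
    rw [← mul_pow, hP]; ring
  linear_combination key - eulerProd K 3 * hP4 + (theta 1 1 2 ^ 3 + X * cubeVar (psi K) ^ 3)
    * eulerProd K 1 ^ 4 * ha

theorem exists_primitive_cube_root : ∃ w : ℂ, 1 + w + w ^ 2 = 0 := by
  obtain ⟨w, hw⟩ := IsAlgClosed.exists_root
    (Polynomial.C (1 : ℂ) * Polynomial.X ^ 2 + Polynomial.C 1 * Polynomial.X + Polynomial.C 1)
    (by rw [Polynomial.degree_quadratic one_ne_zero]; norm_num)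
  refine ⟨w, ?_⟩
  rw [Polynomial.IsRoot.def] at hw
  simp only [Polynomial.eval_add, Polynomial.eval_mul, Polynomial.eval_pow, Polynomial.eval_C,
    Polynomial.eval_X] at hw
  linear_combination hw

theorem map_theta {R S : Type*} [CommRing R] [CommRing S] (g : R →+* S) (ε : R) {a : ℕ}
    (ha : 0 < a) (b : ℕ) : PowerSeries.map g (theta ε a b) = theta (g ε) a b := by
  have hm : 0 < a + b := by omega
  rw [theta, map_mul, map_mul, map_poch _ _ _ hm, map_poch _ _ _ hm, map_poch _ _ _ hm, map_neg,
    map_one, theta]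

/-- The cube root of unity occurs only in the proof, so the identity descends from ℂ to ℚ. -/
theorem phi_cubic :
    (cubeVar (theta (-1) 1 1) ^ 3 - 8 * X * theta (-1) 1 5 ^ 3) * cubeVar (theta (-1) 1 1)
      = theta (-1 : ℚ) 1 1 ^ 4 := by
  obtain ⟨w, hw⟩ := exists_primitive_cube_root
  refine map_injective (algebraMap ℚ ℂ) (algebraMap ℚ ℂ).injective ?_
  have := phi_cubic_of_root hw
  simpa only [map_mul, map_sub, map_pow, map_expand, map_theta _ _ one_pos, map_neg, map_one,
    map_ofNat, PowerSeries.map_X] using this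

theorem psi_cubic :
    (theta 1 1 2 ^ 3 + X * cubeVar (psi ℚ) ^ 3) * cubeVar (psi ℚ) = psi ℚ ^ 4 := by
  obtain ⟨w, hw⟩ := exists_primitive_cube_root
  refine map_injective (algebraMap ℚ ℂ) (algebraMap ℚ ℂ).injective ?_
  have := psi_cubic_of_root hw
  have hpsi : PowerSeries.map (algebraMap ℚ ℂ) (psi ℚ) = psi ℂ := by
    refine mul_right_cancel₀ (eulerProd_ne_zero one_pos) ?_
    rw [psi_mul, ← map_eulerProd (algebraMap ℚ ℂ) one_pos, ← map_mul, psi_mul, map_pow,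
      map_eulerProd _ two_pos]
  simpa only [map_mul, map_add, map_pow, map_expand, map_theta _ _ one_pos, map_one,
    PowerSeries.map_X, hpsi] using this

end CubicIdentities

/-! ### The substitution q ↦ -q -/

section SignChange

variable {R : Type*} [CommRing R]

theorem rescale_neg_one_eulerProd_of_even {r : ℕ} (hr : 0 < r) (he : Even r) :
    rescale (-1) (eulerProd R r) = eulerProd R r := by
  rw [eulerProd, rescale_poch _ _ _ hr he.neg_one_pow, he.neg_one_pow, mul_one]

/-- Only the factors with odd multiples of r change sign, and ∏(1 + q^{r(2k+1)}) = f_{2r}²/(f_r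
f_{4r}). -/
theorem rescale_neg_one_eulerProd_of_odd {r : ℕ} (ho : Odd r) :
    rescale (-1) (eulerProd R r) * (eulerProd R r * eulerProd R (4 * r))
      = eulerProd R (2 * r) ^ 3 := by
  have hr : 0 < r := ho.pos
  have hr2 : 0 < 2 * r := by omega
  have hs : eulerProd R r = poch (-1) r (2 * r) * eulerProd R (2 * r) := by
    rw [eulerProd, eulerProd, poch_split (-1 : R) r (k := 2) hr two_pos]
    simp only [prod_range_succ, prod_range_zero, one_mul]
    rw [mul_zero, add_zero, mul_one, ← two_mul]
  have h1 : rescale (-1) (eulerProd R r) = poch 1 r (2 * r) * eulerProd R (2 * r) := by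
    rw [hs, map_mul, rescale_neg_one_eulerProd_of_even hr2 (even_two_mul r),
      rescale_poch _ _ _ hr2 (even_two_mul r).neg_one_pow, ho.neg_one_pow, neg_mul_neg, one_mul]
  have h2 := congrArg (expand r hr.ne') (poch_one_one_two_mul (R := R))
  rw [map_mul, map_mul, map_pow, expand_poch _ _ two_pos, expand_eulerProd one_pos,
    expand_eulerProd two_pos, expand_eulerProd four_pos, mul_one, mul_comm r 2, mul_comm r 4] at h2
  rw [h1]
  linear_combination eulerProd R (2 * r) * h2

theorem rescale_neg_one_cubeVar (F : R⟦X⟧) :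
    rescale (-1) (cubeVar F) = cubeVar (rescale (-1) F) := by
  ext n
  rw [coeff_rescale, coeff_expand, coeff_expand]
  split_ifs with h
  · obtain ⟨k, rfl⟩ := h
    rw [coeff_rescale, pow_mul, Nat.mul_div_cancel_left _ three_pos]
    norm_num
  · rw [mul_zero]

/-- The power series `ψ(-q)`. -/
noncomputable def psiNeg : ℚ⟦X⟧ := rescale (-1) (psi ℚ)

/-- The power series `f(-q, q ^ 2)`. -/
noncomputable def thetaNeg : ℚ⟦X⟧ := rescale (-1) (theta 1 1 2)

theorem psiNeg_mul : psiNeg * eulerProd ℚ 2 = eulerProd ℚ 1 * eulerProd ℚ 4 := by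
  have h := congrArg (rescale (-1)) (psi_mul (K := ℚ))
  rw [map_mul, map_pow, rescale_neg_one_eulerProd_of_even two_pos even_two] at h
  have h1 := rescale_neg_one_eulerProd_of_odd (R := ℚ) odd_one
  norm_num at h1
  refine mul_right_cancel₀ (pow_ne_zero 2 (eulerProd_ne_zero (K := ℚ) two_pos)) ?_
  rw [← psiNeg] at h
  linear_combination (eulerProd ℚ 1 * eulerProd ℚ 4) * h - psiNeg * h1

theorem thetaNeg_mul : thetaNeg * (eulerProd ℚ 2 ^ 2 * eulerProd ℚ 3 ^ 2 * eulerProd ℚ 12 ^ 2)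
    = eulerProd ℚ 1 * eulerProd ℚ 4 * eulerProd ℚ 6 ^ 5 := by
  have h := congrArg (rescale (-1)) (theta_one_one_two_mul (R := ℚ))
  rw [map_mul, map_mul, map_mul, map_pow, rescale_neg_one_eulerProd_of_even two_pos even_two,
    rescale_neg_one_eulerProd_of_even (by norm_num) (show Even 6 by decide), ← thetaNeg] at h
  have h1 := rescale_neg_one_eulerProd_of_odd (R := ℚ) odd_one
  have h3 := rescale_neg_one_eulerProd_of_odd (R := ℚ) (show Odd 3 by decide)
  norm_num at h1 h3
  have h33 : (rescale (-1) (eulerProd ℚ 3)) ^ 2 * (eulerProd ℚ 3 * eulerProd ℚ 12) ^ 2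
      = eulerProd ℚ 6 ^ 6 := by rw [← mul_pow, h3]; ring
  refine mul_right_cancel₀ (mul_ne_zero (eulerProd_ne_zero (K := ℚ) two_pos)
    (eulerProd_ne_zero (K := ℚ) (show 0 < 6 by norm_num))) ?_
  linear_combination (eulerProd ℚ 1 * eulerProd ℚ 4 * (eulerProd ℚ 3 * eulerProd ℚ 12) ^ 2) * h
    - thetaNeg * eulerProd ℚ 6 * (eulerProd ℚ 3 * eulerProd ℚ 12) ^ 2 * h1
    + eulerProd ℚ 2 * eulerProd ℚ 1 * eulerProd ℚ 4 * h33

theorem psiNeg_dissection : psiNeg = cubeVar thetaNeg - X * cubeVar (cubeVar psiNeg) := by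
  have h := congrArg (rescale (-1)) (psi_dissection (K := ℚ))
  rw [map_add, map_mul, rescale_neg_one_cubeVar, rescale_neg_one_cubeVar,
    rescale_neg_one_cubeVar, rescale_X, ← psiNeg, ← thetaNeg, map_neg, map_one] at h
  linear_combination h

theorem psiNeg_cubic : (thetaNeg ^ 3 - X * cubeVar psiNeg ^ 3) * cubeVar psiNeg = psiNeg ^ 4 := by
  have h := congrArg (rescale (-1)) psi_cubic
  rw [map_mul, map_add, map_mul, map_pow, map_pow, map_pow, rescale_neg_one_cubeVar,
    rescale_X, ← psiNeg, ← thetaNeg, map_neg, map_one] at h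
  linear_combination h

end SignChange

/-! ### Relations between Euler products of levels 6 and 12 -/

section LevelTwelve

/-- A shorthand for the field of fractions of `ℚ⟦X⟧`. -/
abbrev SeriesField : Type := FractionRing ℚ⟦X⟧

/-- The inclusion of `ℚ⟦X⟧` in its field of fractions. -/
noncomputable abbrev toField : ℚ⟦X⟧ →+* SeriesField := algebraMap ℚ⟦X⟧ SeriesField

theorem toField_injective : Function.Injective toField := IsFractionRing.injective _ _

theorem toField_eulerProd_ne_zero {r : ℕ} (hr : 0 < r) : toField (eulerProd ℚ r) ≠ 0 := by
  rw [Ne, map_eq_zero_iff _ toField_injective]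
  exact eulerProd_ne_zero hr

theorem toField_inv {D : ℚ⟦X⟧} (h : constantCoeff D = 1) : toField D⁻¹ = (toField D)⁻¹ := by
  refine eq_inv_of_mul_eq_one_left ?_
  rw [← map_mul, PowerSeries.inv_mul_cancel, map_one]
  rw [h]; exact one_ne_zero

/-- Passing to the fraction field lets the theta functions be replaced by quotients of Euler
products and the denominators be cleared. -/
theorem phi_cubic_eulerProd :
    eulerProd ℚ 3 ^ 9 * eulerProd ℚ 2 ^ 4
      - 8 * X * eulerProd ℚ 1 ^ 3 * eulerProd ℚ 6 ^ 9 * eulerProd ℚ 2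
      = eulerProd ℚ 1 ^ 8 * eulerProd ℚ 6 ^ 4 * eulerProd ℚ 3 := by
  refine toField_injective ?_
  have hP := congrArg toField (theta_neg_one_one_one_mul (R := ℚ))
  have hb := congrArg toField (theta_neg_one_one_five_mul (R := ℚ))
  have ha := congrArg (toField ∘ cubeVar) (theta_neg_one_one_one_mul (R := ℚ))
  have h := congrArg toField phi_cubic
  simp only [Function.comp_apply, map_mul cubeVar, map_pow cubeVar, cubeVar_eulerProd one_pos,
    cubeVar_eulerProd two_pos] at ha
  norm_num at ha
  simp only [map_mul, map_pow, map_sub, map_ofNat] at h ha hb hP ⊢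
  have f1 := toField_eulerProd_ne_zero one_pos
  have f2 := toField_eulerProd_ne_zero two_pos
  have f3 := toField_eulerProd_ne_zero three_pos
  have f6 := toField_eulerProd_ne_zero (show 0 < 6 by norm_num)
  rw [← eq_div_iff f2] at hP
  rw [← eq_div_iff f6] at ha
  rw [← eq_div_iff (mul_ne_zero f2 f3)] at hb
  rw [hP, ha, hb] at h
  field_simp at h
  linear_combination h

theorem psi_cubic_eulerProd :
    eulerProd ℚ 2 ^ 3 * eulerProd ℚ 3 ^ 9 * eulerProd ℚ 1
      + X * eulerProd ℚ 6 ^ 9 * eulerProd ℚ 1 ^ 4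
      = eulerProd ℚ 2 ^ 8 * eulerProd ℚ 3 ^ 4 * eulerProd ℚ 6 := by
  refine toField_injective ?_
  have hP := congrArg toField (psi_mul (K := ℚ))
  have hb := congrArg toField (theta_one_one_two_mul (R := ℚ))
  have ha := congrArg (toField ∘ cubeVar) (psi_mul (K := ℚ))
  have h := congrArg toField psi_cubic
  simp only [Function.comp_apply, map_mul cubeVar, map_pow cubeVar, cubeVar_eulerProd one_pos,
    cubeVar_eulerProd two_pos] at ha
  norm_num at ha
  simp only [map_mul, map_pow, map_add] at h ha hb hP ⊢
  have f1 := toField_eulerProd_ne_zero one_pos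
  have f2 := toField_eulerProd_ne_zero two_pos
  have f3 := toField_eulerProd_ne_zero three_pos
  have f6 := toField_eulerProd_ne_zero (show 0 < 6 by norm_num)
  rw [← eq_div_iff f1] at hP
  rw [← eq_div_iff f3] at ha
  rw [← eq_div_iff (mul_ne_zero f1 f6)] at hb
  rw [hP, ha, hb] at h
  field_simp at h
  linear_combination h

/-- The rational points of the curve behind the relations between level 6 and level 12. -/
theorem eq_one_sub_of_relations {x y v w p : ℚ⟦X⟧} (hx : constantCoeff x = 0)
    (hy : constantCoeff y = 1) (hw : constantCoeff w = 1) (h1 : 4 * y + x ^ 2 = v ^ 2)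
    (h2 : 1 - 4 * x * y = w ^ 2) (h3 : y - 2 * x ^ 2 = p * w) (h4 : 2 + x * y = v * p) :
    y = 1 - x ∧ w = 1 - 2 * x := by
  -- The product (pvw)² is computed in two ways from `h1`–`h4`. The difference is four times a
  -- difference of two cubes, so the curve has a linear-in-y factor; the constant term 3 of the
  -- other factor excludes it.
  have hcube : (y + x ^ 2 - (1 - x * y)) *
      ((y + x ^ 2) ^ 2 + (y + x ^ 2) * (1 - x * y) + (1 - x * y) ^ 2) = 0 := by
    have h4' : (4 : ℚ⟦X⟧) ≠ 0 := by
      intro h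
      have := congrArg constantCoeff h
      rw [map_ofNat, map_zero] at this
      norm_num at this
    have e : (y - 2 * x ^ 2) ^ 2 * (4 * y + x ^ 2) = (2 + x * y) ^ 2 * (1 - 4 * x * y) := by
      rw [h3, h1, h4, h2]; ring
    refine mul_left_cancel₀ h4' ?_
    linear_combination e
  have hne : (y + x ^ 2) ^ 2 + (y + x ^ 2) * (1 - x * y) + (1 - x * y) ^ 2 ≠ 0 := by
    intro h
    have := congrArg constantCoeff h
    simp only [map_add, map_sub, map_mul, map_pow, map_one, map_zero, hx, hy] at this
    norm_num at this
  have hlin := (mul_eq_zero.1 hcube).resolve_right hne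
  have hx1 : 1 + x ≠ 0 := by
    intro h
    have := congrArg constantCoeff h
    simp [hx] at this
  have hyx : y = 1 - x := by
    refine mul_right_cancel₀ hx1 ?_
    linear_combination hlin
  refine ⟨hyx, ?_⟩
  have hsq : (w - (1 - 2 * x)) * (w + (1 - 2 * x)) = 0 := by
    rw [hyx] at h2
    linear_combination -h2
  have hne2 : w + (1 - 2 * x) ≠ 0 := by
    intro h
    have := congrArg constantCoeff h
    simp only [map_add, map_sub, map_mul, map_one, map_zero, hx, hw, map_ofNat] at this
    norm_num at this
  exact sub_eq_zero.1 ((mul_eq_zero.1 hsq).resolve_right hne2)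

set_option linter.unusedSimpArgs false in
/-- `φ(-q)² + φ(-q³)²` and `φ(-q³)² - φ(-q)²` as products. -/
theorem level_twelve_relations :
    eulerProd ℚ 1 ^ 4 * eulerProd ℚ 6 ^ 2 * eulerProd ℚ 4 =
        eulerProd ℚ 2 ^ 2 * eulerProd ℚ 3 ^ 4 * eulerProd ℚ 4
        - 4 * X * eulerProd ℚ 1 * eulerProd ℚ 2 ^ 2 * eulerProd ℚ 3 * eulerProd ℚ 12 ^ 3 ∧
    eulerProd ℚ 1 ^ 4 * eulerProd ℚ 6 ^ 2 * eulerProd ℚ 2 * eulerProd ℚ 3 ^ 2 * eulerProd ℚ 12 ^ 3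
        + eulerProd ℚ 2 ^ 3 * eulerProd ℚ 3 ^ 6 * eulerProd ℚ 12 ^ 3 =
      2 * eulerProd ℚ 1 ^ 2 * eulerProd ℚ 4 * eulerProd ℚ 6 ^ 9 := by
  have f1 := toField_eulerProd_ne_zero one_pos
  have f2 := toField_eulerProd_ne_zero two_pos
  have f3 := toField_eulerProd_ne_zero three_pos
  have f4 := toField_eulerProd_ne_zero four_pos
  have f6 := toField_eulerProd_ne_zero (show 0 < 6 by norm_num)
  have f12 := toField_eulerProd_ne_zero (show 0 < 12 by norm_num)
  have c1 := constantCoeff_eulerProd (R := ℚ) one_pos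
  have c2 := constantCoeff_eulerProd (R := ℚ) two_pos
  have c3 := constantCoeff_eulerProd (R := ℚ) three_pos
  have c4 := constantCoeff_eulerProd (R := ℚ) four_pos
  have c6 := constantCoeff_eulerProd (R := ℚ) (show 0 < 6 by norm_num)
  have c12 := constantCoeff_eulerProd (R := ℚ) (show 0 < 12 by norm_num)
  have a1 := congrArg toField phi_cubic_eulerProd
  have a2 := congrArg toField psi_cubic_eulerProd
  have a3 := congrArg (toField ∘ expand 2 two_ne_zero) phi_cubic_eulerProd
  have a4 := congrArg (toField ∘ expand 2 two_ne_zero) psi_cubic_eulerProd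
  simp only [Function.comp_apply, map_mul (expand 2 two_ne_zero), map_pow (expand 2 two_ne_zero),
    map_add (expand 2 two_ne_zero), map_sub (expand 2 two_ne_zero), expand_X,
    map_ofNat (expand 2 two_ne_zero),
    expand_eulerProd one_pos two_ne_zero, expand_eulerProd two_pos two_ne_zero,
    expand_eulerProd three_pos two_ne_zero, expand_eulerProd (show 0 < 6 by norm_num) two_ne_zero]
    at a3 a4
  norm_num only at a3 a4
  simp only [map_mul, map_add, map_sub, map_pow, map_ofNat] at a1 a2 a3 a4
  -- Here w = φ(-q)²/φ(-q³)². The four hypotheses are the ψ-cubic at q², the φ-cubic at q, the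
  -- φ-cubic at q² and the ψ-cubic at q, each divided by a monomial in the Euler products.
  obtain ⟨hy, hw⟩ := eq_one_sub_of_relations
    (x := 2 * X * (eulerProd ℚ 1 * eulerProd ℚ 12 ^ 3 * (eulerProd ℚ 3 ^ 3 * eulerProd ℚ 4)⁻¹))
    (y := eulerProd ℚ 1 ^ 2 * eulerProd ℚ 4 * eulerProd ℚ 6 ^ 9
      * (eulerProd ℚ 2 ^ 3 * eulerProd ℚ 3 ^ 6 * eulerProd ℚ 12 ^ 3)⁻¹)
    (v := 2 * eulerProd ℚ 4 ^ 3 * eulerProd ℚ 1 * eulerProd ℚ 6 ^ 2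
      * (eulerProd ℚ 2 ^ 2 * eulerProd ℚ 3 ^ 3 * eulerProd ℚ 12)⁻¹)
    (w := eulerProd ℚ 1 ^ 4 * eulerProd ℚ 6 ^ 2 * (eulerProd ℚ 2 ^ 2 * eulerProd ℚ 3 ^ 4)⁻¹)
    (p := eulerProd ℚ 2 ^ 7 * eulerProd ℚ 12
      * (eulerProd ℚ 1 ^ 2 * eulerProd ℚ 3 ^ 2 * eulerProd ℚ 4 ^ 3 * eulerProd ℚ 6)⁻¹)
    (by simp) (by simp [c1, c2, c3, c4, c6, c12]) (by simp [c1, c2, c3, c6])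
    (by
      refine toField_injective ?_
      simp only [toField_inv, map_mul, map_add, map_sub, map_pow, map_ofNat, map_one, c1, c2, c3, c4,
        c6, c12, one_pow, mul_one]
      field_simp
      linear_combination 4 * a4)
    (by
      refine toField_injective ?_
      simp only [toField_inv, map_mul, map_add, map_sub, map_pow, map_ofNat, map_one, c1, c2, c3, c4,
        c6, c12, one_pow, mul_one]
      field_simp
      linear_combination a1)
    (by
      refine toField_injective ?_
      simp only [toField_inv, map_mul, map_add, map_sub, map_pow, map_ofNat, map_one, c1, c2, c3, c4,
        c6, c12, one_pow, mul_one]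
      field_simp
      linear_combination a3)
    (by
      refine toField_injective ?_
      simp only [toField_inv, map_mul, map_add, map_sub, map_pow, map_ofNat, map_one, c1, c2, c3, c4,
        c6, c12, one_pow, mul_one]
      field_simp
      linear_combination 2 * a2)
  have hy' := congrArg toField hy
  have hw' := congrArg toField hw
  simp only [toField_inv, map_mul, map_add, map_sub, map_pow, map_ofNat, map_one, c1, c2, c3, c4,
    c6, c12, one_pow, mul_one] at hy' hw'
  -- Eliminating x gives 2y = 1 + w, the relation for the sum of squares; w = 1 - 2x is the one for
  -- the difference.
  have hyw : 2 * (toField (eulerProd ℚ 1) ^ 2 * toField (eulerProd ℚ 4) *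
      toField (eulerProd ℚ 6) ^ 9 * (toField (eulerProd ℚ 2) ^ 3 * toField (eulerProd ℚ 3) ^ 6 *
      toField (eulerProd ℚ 12) ^ 3)⁻¹) = 1 + toField (eulerProd ℚ 1) ^ 4 *
      toField (eulerProd ℚ 6) ^ 2 * (toField (eulerProd ℚ 2) ^ 2 * toField (eulerProd ℚ 3) ^ 4)⁻¹ := by
    linear_combination 2 * hy' - hw'
  clear hy' hy hw
  constructor
  · refine toField_injective ?_
    simp only [map_mul, map_add, map_sub, map_pow, map_ofNat]
    field_simp at hw'
    linear_combination hw'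
  · refine toField_injective ?_
    simp only [map_mul, map_add, map_sub, map_pow, map_ofNat]
    field_simp at hyw
    linear_combination -hyw

end LevelTwelve

/-! ### Powers of the cofactor and their sections -/

section CubicComplement

variable {R : Type*} [CommRing R]

/-- The cofactor of `a(q³) - q b(q³)` in the difference of cubes `a(q³)³ - q³ b(q³)³`. -/
noncomputable def cubicCofactor (a b : R⟦X⟧) : R⟦X⟧ :=
  cubeVar a ^ 2 + X * cubeVar a * cubeVar b + X ^ 2 * cubeVar b ^ 2

theorem sub_mul_cubicCofactor (a b : R⟦X⟧) :
    (cubeVar a - X * cubeVar b) * cubicCofactor a b = cubeVar (a ^ 3 - X * b ^ 3) := by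
  simp only [cubicCofactor, map_sub, map_mul, map_pow, expand_X]
  ring

theorem sect_cubicCofactor (a b : R⟦X⟧) {k : ℕ} (hk : k < 3) :
    sect k (cubicCofactor a b) =
      (if k = 0 then a ^ 2 else 0) + (if k = 1 then a * b else 0)
        + (if k = 2 then b ^ 2 else 0) := by
  rw [← sect_dissection _ _ _ hk, cubicCofactor, map_pow, map_mul, map_pow, mul_assoc]

theorem sect_zero_cubicCofactor_sq (a b : R⟦X⟧) :
    sect 0 (cubicCofactor a b ^ 2) = a ^ 4 + 2 * X * a * b ^ 3 := by
  have e : cubicCofactor a b ^ 2 = cubeVar (a ^ 4 + 2 * X * a * b ^ 3)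
      + X * cubeVar (2 * a ^ 3 * b + X * b ^ 4) + X ^ 2 * cubeVar (3 * a ^ 2 * b ^ 2) := by
    simp only [cubicCofactor, map_add, map_mul, map_pow, map_ofNat, expand_X]
    ring
  rw [e, sect_dissection _ _ _ three_pos]
  simp

theorem cubicCofactor_pow_four (a b : R⟦X⟧) :
    cubicCofactor a b ^ 4 =
      cubeVar (a ^ 8 + 16 * X * a ^ 5 * b ^ 3 + 10 * X ^ 2 * a ^ 2 * b ^ 6)
      + X * cubeVar (4 * a ^ 7 * b + 19 * X * a ^ 4 * b ^ 4 + 4 * X ^ 2 * a * b ^ 7)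
      + X ^ 2 * cubeVar (10 * a ^ 6 * b ^ 2 + 16 * X * a ^ 3 * b ^ 5 + X ^ 2 * b ^ 8) := by
  simp only [cubicCofactor, map_add, map_mul, map_pow, map_ofNat, expand_X]
  ring

theorem sect_zero_cubicCofactor_pow_four (a b : R⟦X⟧) :
    sect 0 (cubicCofactor a b ^ 4) =
      a ^ 8 + 16 * X * a ^ 5 * b ^ 3 + 10 * X ^ 2 * a ^ 2 * b ^ 6 := by
  rw [cubicCofactor_pow_four, sect_dissection _ _ _ three_pos]
  simp

theorem sect_two_cubicCofactor_pow_four (a b : R⟦X⟧) :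
    sect 2 (cubicCofactor a b ^ 4) =
      10 * a ^ 6 * b ^ 2 + 16 * X * a ^ 3 * b ^ 5 + X ^ 2 * b ^ 8 := by
  rw [cubicCofactor_pow_four, sect_dissection _ _ _ (by norm_num)]
  simp

end CubicComplement

/-! ### Sections mod 9 of the four theta quotients -/

section NinefoldSections

/-- The power series `φ(-q)`. -/
noncomputable abbrev phiNeg : ℚ⟦X⟧ := theta (-1) 1 1

/-- The power series `2 f(-q, -q ^ 5)` in the 3-dissection of `φ(-q)`. -/
noncomputable abbrev omegaNeg : ℚ⟦X⟧ := 2 * theta (-1) 1 5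

theorem phiNeg_mul : phiNeg * eulerProd ℚ 2 = eulerProd ℚ 1 ^ 2 := theta_neg_one_one_one_mul

theorem phiNeg_ne_zero : phiNeg ≠ 0 := by
  intro h0
  have := phiNeg_mul
  rw [h0, zero_mul] at this
  exact pow_ne_zero 2 (eulerProd_ne_zero one_pos) this.symm

theorem cubeVar_phiNeg_mul : cubeVar phiNeg * eulerProd ℚ 6 = eulerProd ℚ 3 ^ 2 := by
  have h := congrArg cubeVar phiNeg_mul
  rwa [map_mul, map_pow, cubeVar_eulerProd one_pos, cubeVar_eulerProd two_pos] at h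

theorem cubeVar_psiNeg_mul :
    cubeVar psiNeg * eulerProd ℚ 6 = eulerProd ℚ 3 * eulerProd ℚ 12 := by
  have h := congrArg cubeVar psiNeg_mul
  rwa [map_mul, map_mul, cubeVar_eulerProd one_pos, cubeVar_eulerProd two_pos,
    cubeVar_eulerProd four_pos] at h

theorem phiNeg_dissection :
    phiNeg = cubeVar (cubeVar phiNeg) - X * cubeVar omegaNeg := by
  rw [map_mul, map_ofNat]
  linear_combination theta_neg_one_one_one (R := ℚ)

theorem phiNeg_cubic :
    (cubeVar phiNeg ^ 3 - X * omegaNeg ^ 3) * cubeVar phiNeg = phiNeg ^ 4 := by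
  linear_combination phi_cubic

theorem phiNeg_mul_cubicCofactor :
    phiNeg * cubicCofactor (cubeVar phiNeg) omegaNeg
      = cubeVar (cubeVar phiNeg ^ 3 - X * omegaNeg ^ 3) := by
  rw [← sub_mul_cubicCofactor, ← phiNeg_dissection]

theorem psiNeg_mul_cubicCofactor :
    psiNeg * cubicCofactor thetaNeg (cubeVar psiNeg)
      = cubeVar (thetaNeg ^ 3 - X * cubeVar psiNeg ^ 3) := by
  rw [← sub_mul_cubicCofactor, ← psiNeg_dissection]

/-- With a = φ(-q³) and N = a³ - q b³, the first section is a²/N, which is a³/φ(-q)⁴ by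
`phiNeg_cubic`. Its numerator is a series in q³, and φ(-q)⁻⁴ is the fourth power of the cofactor
over N(q³)⁴. -/
theorem sect_sect_inv_phiNeg {G : ℚ⟦X⟧} (hG : G * phiNeg = 1) :
    (cubeVar phiNeg ^ 3 - X * omegaNeg ^ 3) ^ 4 * sect 0 (sect 0 G) =
      phiNeg ^ 3 * (cubeVar phiNeg ^ 8 + 16 * X * cubeVar phiNeg ^ 5 * omegaNeg ^ 3
        + 10 * X ^ 2 * cubeVar phiNeg ^ 2 * omegaNeg ^ 6) := by
  have hQ := phiNeg_mul_cubicCofactor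
  have hn := phiNeg_cubic
  have hs := sect_cubeVar_mul three_pos (cubeVar phiNeg ^ 3 - X * omegaNeg ^ 3) G
  rw [← hQ, show phiNeg * cubicCofactor (cubeVar phiNeg) omegaNeg * G
    = cubicCofactor (cubeVar phiNeg) omegaNeg by linear_combination cubicCofactor _ _ * hG,
    sect_cubicCofactor _ _ three_pos] at hs
  simp only [if_true, zero_ne_one, if_false, add_zero,
    show (0 : ℕ) ≠ 2 by norm_num] at hs
  rw [← sect_zero_cubicCofactor_pow_four, ← sect_cubeVar_mul three_pos (_ ^ 4) (sect 0 G),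
    ← sect_cubeVar_mul three_pos (phiNeg ^ 3), map_pow, ← hQ, map_pow cubeVar phiNeg]
  refine congrArg (sect 0) ?_
  linear_combination (-cubicCofactor (cubeVar phiNeg) omegaNeg ^ 4) *
    (sect 0 G * hn + cubeVar phiNeg * hs)

/-- The same argument with section 2 taken both times (8 = 3·2 + 2). The first section is b²/N with
b = ψ(-q³), and again b N = ψ(-q)⁴. -/
theorem sect_sect_inv_psiNeg {G : ℚ⟦X⟧} (hG : G * psiNeg = 1) :
    (thetaNeg ^ 3 - X * cubeVar psiNeg ^ 3) ^ 4 * sect 2 (sect 2 G) =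
      psiNeg ^ 3 * (10 * thetaNeg ^ 6 * cubeVar psiNeg ^ 2
        + 16 * X * thetaNeg ^ 3 * cubeVar psiNeg ^ 5 + X ^ 2 * cubeVar psiNeg ^ 8) := by
  have hQ := psiNeg_mul_cubicCofactor
  have hn := psiNeg_cubic
  have h2 : 2 < 3 := by norm_num
  have hs := sect_cubeVar_mul h2 (thetaNeg ^ 3 - X * cubeVar psiNeg ^ 3) G
  rw [← hQ, show psiNeg * cubicCofactor thetaNeg (cubeVar psiNeg) * G
    = cubicCofactor thetaNeg (cubeVar psiNeg) by linear_combination cubicCofactor _ _ * hG,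
    sect_cubicCofactor _ _ h2] at hs
  norm_num at hs
  rw [← sect_two_cubicCofactor_pow_four, ← sect_cubeVar_mul h2 (_ ^ 4) (sect 2 G),
    ← sect_cubeVar_mul h2 (psiNeg ^ 3), map_pow, ← hQ, map_pow cubeVar psiNeg]
  refine congrArg (sect 2) ?_
  linear_combination (-cubicCofactor thetaNeg (cubeVar psiNeg) ^ 4) *
    (sect 2 G * hn + cubeVar psiNeg * hs)

theorem sect_zero_of_phiNeg_sq_mul {S H : ℚ⟦X⟧} (h : phiNeg ^ 2 * S = cubeVar H) :
    (cubeVar phiNeg ^ 3 - X * omegaNeg ^ 3) ^ 2 * sect 0 S =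
      H * (cubeVar phiNeg ^ 4 + 2 * X * cubeVar phiNeg * omegaNeg ^ 3) := by
  rw [← sect_zero_cubicCofactor_sq, ← sect_cubeVar_mul three_pos (_ ^ 2) S,
    ← sect_cubeVar_mul three_pos H, map_pow, ← phiNeg_mul_cubicCofactor]
  refine congrArg (sect 0) ?_
  linear_combination cubicCofactor (cubeVar phiNeg) omegaNeg ^ 2 * h

/-- The formula for φ(-q)² + φ(-q³)² in theta form, shaped to collapse the section in
`sect_one_of_mul_phiNeg_eq_psiNeg`. -/
theorem phiNeg_sq_mul_eq_of_level_twelve_add :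
    cubeVar phiNeg * (omegaNeg * thetaNeg - cubeVar phiNeg * cubeVar psiNeg)
      = phiNeg ^ 2 * cubeVar psiNeg := by
  have f1 := toField_eulerProd_ne_zero one_pos
  have f2 := toField_eulerProd_ne_zero two_pos
  have f3 := toField_eulerProd_ne_zero three_pos
  have f6 := toField_eulerProd_ne_zero (show 0 < 6 by norm_num)
  have f12 := toField_eulerProd_ne_zero (show 0 < 12 by norm_num)
  have hP := congrArg toField phiNeg_mul
  have ha := congrArg toField cubeVar_phiNeg_mul
  have hb := congrArg toField (theta_neg_one_one_five_mul (R := ℚ))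
  have hA := congrArg toField thetaNeg_mul
  have hM := congrArg toField cubeVar_psiNeg_mul
  have h := congrArg toField level_twelve_relations.2
  refine toField_injective ?_
  simp only [map_mul, map_pow, map_sub, map_add, map_ofNat] at hP ha hb hA hM h ⊢
  rw [← eq_div_iff (by positivity)] at hP ha hb hA hM
  rw [hP, ha, hb, hA, hM]
  field_simp
  linear_combination -h

/-- The section is a difference of two products over N. The level 12 relation turns the numerator
into φ(-q)²ψ(-q³), and N φ(-q³) = φ(-q)⁴ cancels the rest. -/
theorem sect_one_of_mul_phiNeg_eq_psiNeg {G : ℚ⟦X⟧} (hG : G * phiNeg = psiNeg) :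
    phiNeg ^ 2 * sect 1 G = cubeVar (phiNeg * psiNeg) := by
  have hs := sect_cubeVar_mul (show 1 < 3 by norm_num) (cubeVar phiNeg ^ 3 - X * omegaNeg ^ 3) G
  have e : cubeVar (cubeVar phiNeg ^ 3 - X * omegaNeg ^ 3) * G
      = cubeVar (thetaNeg * cubeVar phiNeg ^ 2 - X * cubeVar psiNeg * omegaNeg ^ 2)
        + X * cubeVar (thetaNeg * cubeVar phiNeg * omegaNeg - cubeVar psiNeg * cubeVar phiNeg ^ 2)
        + X ^ 2 * cubeVar (thetaNeg * omegaNeg ^ 2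
          - cubeVar psiNeg * cubeVar phiNeg * omegaNeg) := by
    rw [← phiNeg_mul_cubicCofactor]
    have : phiNeg * cubicCofactor (cubeVar phiNeg) omegaNeg * G
        = (cubeVar thetaNeg - X * cubeVar (cubeVar psiNeg))
          * cubicCofactor (cubeVar phiNeg) omegaNeg := by
      rw [← psiNeg_dissection]
      linear_combination cubicCofactor (cubeVar phiNeg) omegaNeg * hG
    rw [this]
    simp only [cubicCofactor, map_sub cubeVar, map_mul cubeVar, map_pow cubeVar, expand_X]
    ring
  rw [e, sect_dissection _ _ _ (by norm_num)] at hs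
  norm_num at hs
  have hn := phiNeg_cubic
  have hl := phiNeg_sq_mul_eq_of_level_twelve_add
  refine mul_left_cancel₀ (pow_ne_zero 2 phiNeg_ne_zero) ?_
  rw [map_mul]
  linear_combination (-sect 1 G) * hn - cubeVar phiNeg * hs + cubeVar phiNeg * hl

theorem expand_two_cubeVar (F : ℚ⟦X⟧) :
    expand 2 two_ne_zero (cubeVar F) = cubeVar (expand 2 two_ne_zero F) := by
  rw [← expand_mul, ← expand_mul]

theorem expand_two_phiNeg_mul :
    expand 2 two_ne_zero phiNeg * eulerProd ℚ 4 = eulerProd ℚ 2 ^ 2 := by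
  have h := congrArg (expand 2 two_ne_zero) phiNeg_mul
  rwa [map_mul, map_pow, expand_eulerProd one_pos, expand_eulerProd two_pos] at h

/-- The formula for φ(-q³)² - φ(-q)² in theta form, used for φ(-q²)/φ(-q). -/
theorem phiNeg_sq_mul_eq_of_level_twelve_sub :
    cubeVar phiNeg * (expand 2 two_ne_zero (cubeVar phiNeg) * cubeVar phiNeg ^ 2
        - X * expand 2 two_ne_zero omegaNeg * cubeVar phiNeg * omegaNeg)
      = phiNeg ^ 2 * cubeVar phiNeg * expand 2 two_ne_zero (cubeVar phiNeg) := by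
  have f1 := toField_eulerProd_ne_zero one_pos
  have f2 := toField_eulerProd_ne_zero two_pos
  have f3 := toField_eulerProd_ne_zero three_pos
  have f4 := toField_eulerProd_ne_zero four_pos
  have f6 := toField_eulerProd_ne_zero (show 0 < 6 by norm_num)
  have f12 := toField_eulerProd_ne_zero (show 0 < 12 by norm_num)
  have hP := congrArg toField phiNeg_mul
  have ha := congrArg toField cubeVar_phiNeg_mul
  have hb := congrArg toField (theta_neg_one_one_five_mul (R := ℚ))
  have ha2 := congrArg (toField ∘ expand 2 two_ne_zero) cubeVar_phiNeg_mul
  have hb2 := congrArg (toField ∘ expand 2 two_ne_zero) (theta_neg_one_one_five_mul (R := ℚ))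
  simp only [Function.comp_apply, map_mul (expand 2 two_ne_zero), map_pow (expand 2 two_ne_zero),
    expand_eulerProd one_pos two_ne_zero, expand_eulerProd two_pos two_ne_zero,
    expand_eulerProd three_pos two_ne_zero, expand_eulerProd (show 0 < 6 by norm_num) two_ne_zero]
    at ha2 hb2
  norm_num only at ha2 hb2
  have h := congrArg toField level_twelve_relations.1
  refine toField_injective ?_
  simp only [map_mul, map_pow, map_sub, map_ofNat] at hP ha hb ha2 hb2 h ⊢
  rw [← eq_div_iff (by positivity)] at hP ha hb ha2 hb2
  rw [hP, ha, hb, ha2, hb2]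
  field_simp
  linear_combination -h

theorem sect_zero_of_mul_phiNeg_eq {G : ℚ⟦X⟧}
    (hG : G * phiNeg = expand 2 two_ne_zero phiNeg) :
    phiNeg ^ 2 * sect 0 G = cubeVar (phiNeg * expand 2 two_ne_zero phiNeg) := by
  have hs := sect_cubeVar_mul three_pos (cubeVar phiNeg ^ 3 - X * omegaNeg ^ 3) G
  have hd := congrArg (expand 2 two_ne_zero) phiNeg_dissection
  rw [map_sub, map_mul (expand 2 two_ne_zero) X, expand_X, expand_two_cubeVar (cubeVar phiNeg),
    expand_two_cubeVar omegaNeg] at hd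
  have hl := phiNeg_sq_mul_eq_of_level_twelve_sub
  have hn := phiNeg_cubic
  rw [map_mul, ← expand_two_cubeVar]
  generalize expand 2 two_ne_zero phiNeg = D at hd hG
  generalize expand 2 two_ne_zero (cubeVar phiNeg) = A at hd hl ⊢
  generalize expand 2 two_ne_zero omegaNeg = B at hd hl
  -- After q ↦ q² the dissection of the numerator has its second term at q², so that term meets the
  -- q¹ term of the cofactor in section 0 and contributes a carry `X`.
  have e : cubeVar (cubeVar phiNeg ^ 3 - X * omegaNeg ^ 3) * G
      = cubeVar (A * cubeVar phiNeg ^ 2 - X * B * cubeVar phiNeg * omegaNeg)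
        + X * cubeVar (A * cubeVar phiNeg * omegaNeg - X * B * omegaNeg ^ 2)
        + X ^ 2 * cubeVar (A * omegaNeg ^ 2 - B * cubeVar phiNeg ^ 2) := by
    rw [← phiNeg_mul_cubicCofactor]
    have : phiNeg * cubicCofactor (cubeVar phiNeg) omegaNeg * G
        = (cubeVar A - X ^ 2 * cubeVar B) * cubicCofactor (cubeVar phiNeg) omegaNeg := by
      rw [← hd]
      linear_combination cubicCofactor (cubeVar phiNeg) omegaNeg * hG
    rw [this]
    simp only [cubicCofactor, map_sub cubeVar, map_mul cubeVar, map_pow cubeVar, expand_X]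
    ring
  rw [e, sect_dissection _ _ _ three_pos] at hs
  norm_num at hs
  refine mul_left_cancel₀ (pow_ne_zero 2 phiNeg_ne_zero) ?_
  linear_combination (-sect 0 G) * hn - cubeVar phiNeg * hs + hl

theorem mk_nine_mul_add (u : ℕ → ℕ) (j k : ℕ) :
    (PowerSeries.mk fun n => (u (9 * n + (3 * j + k)) : ℚ))
      = sect j (sect k (PowerSeries.mk fun n => (u n : ℚ))) := by
  ext n
  simp only [sect, coeff_mk]
  congr 2
  ring

end NinefoldSections

/-! ### Translation into Euler products -/

section FinalIdentities

theorem mk_overp_nine :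
    (PowerSeries.mk fun n => (overp (9 * n) : ℚ)) =
      eulerProd ℚ 2 ^ 13 * eulerProd ℚ 3 ^ 24 * (eulerProd ℚ 1 ^ 26 * eulerProd ℚ 6 ^ 12)⁻¹
      + 128 * X * (eulerProd ℚ 2 ^ 10 * eulerProd ℚ 3 ^ 15
          * (eulerProd ℚ 1 ^ 23 * eulerProd ℚ 6 ^ 3)⁻¹)
      + 640 * X ^ 2 * (eulerProd ℚ 2 ^ 7 * eulerProd ℚ 3 ^ 6 * eulerProd ℚ 6 ^ 6
          * (eulerProd ℚ 1 ^ 20)⁻¹) := by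
  have f1 := toField_eulerProd_ne_zero one_pos
  have f2 := toField_eulerProd_ne_zero two_pos
  have f3 := toField_eulerProd_ne_zero three_pos
  have f6 := toField_eulerProd_ne_zero (show 0 < 6 by norm_num)
  have c1 := constantCoeff_eulerProd (R := ℚ) one_pos
  have c6 := constantCoeff_eulerProd (R := ℚ) (show 0 < 6 by norm_num)
  have hG : (PowerSeries.mk fun n => (overp n : ℚ)) * phiNeg = 1 := by
    refine mul_right_cancel₀ (eulerProd_ne_zero two_pos) ?_
    rw [mul_assoc, phiNeg_mul, mk_overp_mul, one_mul]
  have h := congrArg toField (sect_sect_inv_phiNeg hG)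
  rw [← mk_nine_mul_add] at h
  have hP := congrArg toField phiNeg_mul
  have ha := congrArg toField cubeVar_phiNeg_mul
  have hb := congrArg toField (theta_neg_one_one_five_mul (R := ℚ))
  have hn := congrArg toField phiNeg_cubic
  rw [map_mul, map_pow toField (_ - _)] at h
  rw [map_mul] at hn
  refine toField_injective ?_
  generalize toField (cubeVar phiNeg ^ 3 - X * omegaNeg ^ 3) = N at h hn
  simp only [toField_inv, map_mul, map_add, map_pow, map_ofNat, c1, c6, one_pow, mul_one]
    at hP ha hb hn h ⊢
  rw [← eq_div_iff (by positivity)] at hP ha hb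
  have ha0 : toField (cubeVar phiNeg) ≠ 0 := by rw [ha]; positivity
  rw [← eq_div_iff ha0, hP, ha] at hn
  rw [hn, hP, ha, hb, mul_comm, ← eq_div_iff (by positivity)] at h
  -- The coefficients are 128 = 16·2³ and 640 = 10·2⁶, from b = 2Ω.
  refine h.trans ?_
  field_simp
  ring

theorem mk_pod_nine :
    (PowerSeries.mk fun n => (pod (9 * n + 8) : ℚ)) =
      10 * (eulerProd ℚ 2 * eulerProd ℚ 6 ^ 24
        * (eulerProd ℚ 1 ^ 7 * eulerProd ℚ 3 ^ 6 * eulerProd ℚ 4 ^ 7 * eulerProd ℚ 12 ^ 6)⁻¹)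
      + 16 * X * (eulerProd ℚ 2 ^ 7 * eulerProd ℚ 3 ^ 3 * eulerProd ℚ 6 ^ 6 * eulerProd ℚ 12 ^ 3
        * (eulerProd ℚ 1 ^ 10 * eulerProd ℚ 4 ^ 10)⁻¹)
      + X ^ 2 * (eulerProd ℚ 2 ^ 13 * eulerProd ℚ 3 ^ 12 * eulerProd ℚ 12 ^ 12
        * (eulerProd ℚ 1 ^ 13 * eulerProd ℚ 4 ^ 13 * eulerProd ℚ 6 ^ 12)⁻¹) := by
  have f1 := toField_eulerProd_ne_zero one_pos
  have f2 := toField_eulerProd_ne_zero two_pos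
  have f3 := toField_eulerProd_ne_zero three_pos
  have f4 := toField_eulerProd_ne_zero four_pos
  have f6 := toField_eulerProd_ne_zero (show 0 < 6 by norm_num)
  have f12 := toField_eulerProd_ne_zero (show 0 < 12 by norm_num)
  have c1 := constantCoeff_eulerProd (R := ℚ) one_pos
  have c3 := constantCoeff_eulerProd (R := ℚ) three_pos
  have c4 := constantCoeff_eulerProd (R := ℚ) four_pos
  have c6 := constantCoeff_eulerProd (R := ℚ) (show 0 < 6 by norm_num)
  have c12 := constantCoeff_eulerProd (R := ℚ) (show 0 < 12 by norm_num)
  have hG : (PowerSeries.mk fun n => (pod n : ℚ)) * psiNeg = 1 := by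
    refine mul_right_cancel₀ (eulerProd_ne_zero two_pos) ?_
    rw [mul_assoc, psiNeg_mul, mk_pod_mul, one_mul]
  have h := congrArg toField (sect_sect_inv_psiNeg hG)
  rw [← mk_nine_mul_add] at h
  have hP := congrArg toField psiNeg_mul
  have ha := congrArg toField thetaNeg_mul
  have hb := congrArg toField cubeVar_psiNeg_mul
  have hn := congrArg toField psiNeg_cubic
  rw [map_mul, map_pow toField (_ - _)] at h
  rw [map_mul] at hn
  refine toField_injective ?_
  generalize toField (thetaNeg ^ 3 - X * cubeVar psiNeg ^ 3) = N at h hn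
  simp only [toField_inv, map_mul, map_add, map_pow, map_ofNat, c1, c3, c4, c6, c12, one_pow,
    mul_one] at hP ha hb hn h ⊢
  rw [← eq_div_iff (by positivity)] at hP ha hb
  have hb0 : toField (cubeVar psiNeg) ≠ 0 := by rw [hb]; positivity
  rw [← eq_div_iff hb0, hP, hb] at hn
  rw [hn, hP, ha, hb, mul_comm, ← eq_div_iff (by positivity)] at h
  refine h.trans ?_
  field_simp

theorem mk_ped_nine :
    (PowerSeries.mk fun n => (ped (9 * n + 1) : ℚ)) =
      eulerProd ℚ 2 ^ 2 * eulerProd ℚ 3 ^ 4 * eulerProd ℚ 4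
        * (eulerProd ℚ 1 ^ 5 * eulerProd ℚ 6 ^ 2)⁻¹
      + 24 * X * (eulerProd ℚ 2 ^ 3 * eulerProd ℚ 3 ^ 3 * eulerProd ℚ 4 * eulerProd ℚ 6 ^ 3
        * (eulerProd ℚ 1 ^ 10)⁻¹) := by
  have f1 := toField_eulerProd_ne_zero one_pos
  have f2 := toField_eulerProd_ne_zero two_pos
  have f3 := toField_eulerProd_ne_zero three_pos
  have f4 := toField_eulerProd_ne_zero four_pos
  have f6 := toField_eulerProd_ne_zero (show 0 < 6 by norm_num)
  have c1 := constantCoeff_eulerProd (R := ℚ) one_pos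
  have c6 := constantCoeff_eulerProd (R := ℚ) (show 0 < 6 by norm_num)
  have hG : (PowerSeries.mk fun n => (ped n : ℚ)) * phiNeg = psiNeg := by
    refine mul_right_cancel₀ (mul_ne_zero (eulerProd_ne_zero two_pos)
      (eulerProd_ne_zero (K := ℚ) one_pos)) ?_
    linear_combination (PowerSeries.mk fun n => (ped n : ℚ)) * eulerProd ℚ 1 * phiNeg_mul
      + eulerProd ℚ 1 ^ 2 * mk_ped_mul - eulerProd ℚ 1 * psiNeg_mul
  have h := congrArg toField
    (sect_zero_of_phiNeg_sq_mul (sect_one_of_mul_phiNeg_eq_psiNeg hG))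
  rw [← mk_nine_mul_add] at h
  have hP := congrArg toField phiNeg_mul
  have hM := congrArg toField psiNeg_mul
  have ha := congrArg toField cubeVar_phiNeg_mul
  have hb := congrArg toField (theta_neg_one_one_five_mul (R := ℚ))
  have hn := congrArg toField phiNeg_cubic
  have hc := congrArg toField phi_cubic_eulerProd
  rw [map_mul, map_pow toField (_ - _)] at h
  rw [map_mul] at hn
  refine toField_injective ?_
  generalize toField (cubeVar phiNeg ^ 3 - X * omegaNeg ^ 3) = N at h hn
  simp only [toField_inv, map_mul, map_add, map_sub, map_pow, map_ofNat, c1, c6, one_pow, mul_one]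
    at hP hM ha hb hn hc h ⊢
  rw [← eq_div_iff (by positivity)] at hP hM ha hb
  have ha0 : toField (cubeVar phiNeg) ≠ 0 := by rw [ha]; positivity
  rw [← eq_div_iff ha0, hP, ha] at hn
  rw [hn, hP, hM, ha, hb, mul_comm, ← eq_div_iff (by positivity)] at h
  refine h.trans ?_
  field_simp
  -- The numerator a⁴ + 2qab³ equals aN + 3qab³ with b = 2Ω, hence the coefficient 24 = 3·2³; the
  -- cubic identity `hc` is what allows a³ to be traded for N + qb³.
  linear_combination hc

theorem mk_overpOdd_nine :
    (PowerSeries.mk fun n => (overpOdd (9 * n) : ℚ)) =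
      eulerProd ℚ 2 ^ 5 * eulerProd ℚ 3 ^ 4
        * (eulerProd ℚ 1 ^ 6 * eulerProd ℚ 4 * eulerProd ℚ 6 ^ 2)⁻¹
      + 24 * X * (eulerProd ℚ 2 ^ 6 * eulerProd ℚ 3 ^ 3 * eulerProd ℚ 6 ^ 3
        * (eulerProd ℚ 1 ^ 11 * eulerProd ℚ 4)⁻¹) := by
  have f1 := toField_eulerProd_ne_zero one_pos
  have f2 := toField_eulerProd_ne_zero two_pos
  have f3 := toField_eulerProd_ne_zero three_pos
  have f4 := toField_eulerProd_ne_zero four_pos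
  have f6 := toField_eulerProd_ne_zero (show 0 < 6 by norm_num)
  have c1 := constantCoeff_eulerProd (R := ℚ) one_pos
  have c4 := constantCoeff_eulerProd (R := ℚ) four_pos
  have c6 := constantCoeff_eulerProd (R := ℚ) (show 0 < 6 by norm_num)
  have hG : (PowerSeries.mk fun n => (overpOdd n : ℚ)) * phiNeg
      = expand 2 two_ne_zero phiNeg := by
    refine mul_right_cancel₀ (mul_ne_zero (eulerProd_ne_zero two_pos)
      (eulerProd_ne_zero (K := ℚ) four_pos)) ?_
    linear_combination (PowerSeries.mk fun n => (overpOdd n : ℚ)) * eulerProd ℚ 4 * phiNeg_mul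
      + mk_overpOdd_mul - eulerProd ℚ 2 * expand_two_phiNeg_mul
  have h := congrArg toField (sect_zero_of_phiNeg_sq_mul (sect_zero_of_mul_phiNeg_eq hG))
  rw [← mk_nine_mul_add] at h
  have hP := congrArg toField phiNeg_mul
  have hM := congrArg toField expand_two_phiNeg_mul
  have ha := congrArg toField cubeVar_phiNeg_mul
  have hb := congrArg toField (theta_neg_one_one_five_mul (R := ℚ))
  have hn := congrArg toField phiNeg_cubic
  have hc := congrArg toField phi_cubic_eulerProd
  rw [map_mul, map_pow toField (_ - _)] at h
  rw [map_mul] at hn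
  refine toField_injective ?_
  generalize toField (cubeVar phiNeg ^ 3 - X * omegaNeg ^ 3) = N at h hn
  simp only [toField_inv, map_mul, map_add, map_sub, map_pow, map_ofNat, c1, c4, c6, one_pow,
    mul_one] at hP hM ha hb hn hc h ⊢
  rw [← eq_div_iff (by positivity)] at hP hM ha hb
  have ha0 : toField (cubeVar phiNeg) ≠ 0 := by rw [ha]; positivity
  rw [← eq_div_iff ha0, hP, ha] at hn
  rw [hn, hP, hM, ha, hb, mul_comm, ← eq_div_iff (by positivity)] at h
  refine h.trans ?_
  field_simp
  linear_combination hc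

end FinalIdentities

theorem proposition5p3 :
    (PowerSeries.mk fun n => (ped (9 * n + 1) : ℚ)) =
        fq 2 ^ 2 * fq 3 ^ 4 * fq 4 * (fq 1 ^ 5 * fq 6 ^ 2)⁻¹
        + 24 * PowerSeries.X * (fq 2 ^ 3 * fq 3 ^ 3 * fq 4 * fq 6 ^ 3 * (fq 1 ^ 10)⁻¹) ∧
    (PowerSeries.mk fun n => (pod (9 * n + 8) : ℚ)) =
        10 * (fq 2 * fq 6 ^ 24 * (fq 1 ^ 7 * fq 3 ^ 6 * fq 4 ^ 7 * fq 12 ^ 6)⁻¹)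
        + 16 * PowerSeries.X *
          (fq 2 ^ 7 * fq 3 ^ 3 * fq 6 ^ 6 * fq 12 ^ 3 * (fq 1 ^ 10 * fq 4 ^ 10)⁻¹)
        + PowerSeries.X ^ 2 *
          (fq 2 ^ 13 * fq 3 ^ 12 * fq 12 ^ 12 * (fq 1 ^ 13 * fq 4 ^ 13 * fq 6 ^ 12)⁻¹) ∧
    (PowerSeries.mk fun n => (overpOdd (9 * n) : ℚ)) =
        fq 2 ^ 5 * fq 3 ^ 4 * (fq 1 ^ 6 * fq 4 * fq 6 ^ 2)⁻¹
        + 24 * PowerSeries.X * (fq 2 ^ 6 * fq 3 ^ 3 * fq 6 ^ 3 * (fq 1 ^ 11 * fq 4)⁻¹) ∧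
    (PowerSeries.mk fun n => (overp (9 * n) : ℚ)) =
        fq 2 ^ 13 * fq 3 ^ 24 * (fq 1 ^ 26 * fq 6 ^ 12)⁻¹
        + 128 * PowerSeries.X * (fq 2 ^ 10 * fq 3 ^ 15 * (fq 1 ^ 23 * fq 6 ^ 3)⁻¹)
        + 640 * PowerSeries.X ^ 2 * (fq 2 ^ 7 * fq 3 ^ 6 * fq 6 ^ 6 * (fq 1 ^ 20)⁻¹) := by
  simp only [fq_eq_eulerProd (show 0 < 1 by norm_num), fq_eq_eulerProd (show 0 < 2 by norm_num),
    fq_eq_eulerProd (show 0 < 3 by norm_num), fq_eq_eulerProd (show 0 < 4 by norm_num),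
    fq_eq_eulerProd (show 0 < 6 by norm_num), fq_eq_eulerProd (show 0 < 12 by norm_num)]
  exact ⟨mk_ped_nine, mk_pod_nine, mk_overpOdd_nine, mk_overp_nine⟩
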